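/- All graphs are finite, simple and undirected, and $\log$ denotes the logarithm to base $2$. For a graph $G$ on $n$ vertices, let $N(U)$ be the set of vertices adjacent to some vertex of $U$, let $\Delta(G)$ be the maximum degree, and let $G[U]$ be the subgraph induced by $U$. - $G$ is an $\alpha$-expander if $|N(U)\setminus U|\ge \alpha|U|$ for every $U\subseteq V(G)$ with $|U|\le n/2$. - $G$ is $\kappa$-max-degree-robust with threshold $d$ if $\Delta(G[U])\ge d$ for every $U\subseteq V(G)$ with $|U|\ge \kappa n$. - Put $c_\alpha = \frac{2}{\log(1+\alpha)}+3$. $G$ is $\kappa$-odd-cycle-robust with parameters $(\alpha,\ell)$ if for every $U\subseteq V(G)$ with $|U|\ge\kappa n$ such that $G[U]$ is an $\alpha$-expander, $G[U]$ contains an odd cycle $C$ of length $\ell\le |C|\le 3\,c_{\alpha/2}\log n$. - $G$ contains $H$ as a topological minor if there are an injective map $\sigma:V(H)\to V(G)$ and, for every edge $\{u,v\}$ of $H$, a path $p_{uv}$ in $G$ from $\sigma(u)$ to $\sigma(v)$ (an edge embedding), such that no $p_{uv}$ passes through $\sigma(w)$ for a vertex $w\notin\{u,v\}$ of $H$, and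 any two different paths are vertex-disjoint except for common endpoints. **Theorem (Embedding Theorem).** For every $\alpha>0$ there are $\varepsilon>0$ and $n_0>0$ such that the following holds. Let $G$ be an $\alpha$-expander on $n>n_0$ vertices, let $k\ge 6$ be a real number (which may depend on $G$), and let $H$ be a graph with at most $\frac{\varepsilon n}{k\log n}$ vertices and at most $\frac{\varepsilon n}{k\log n}$ edges. If $G$ is $(1-4/k)$-max-degree-robust with threshold $550\,\Delta(H)/\alpha^2$, then $G$ contains $H$ as a topological minor. Furthermore, if $G$ is also $(1-2/k)$-odd-cycle-robust with parameters $(\beta,\,1+2/\beta)$, where $\beta=\frac{\alpha}{3(1+\alpha)}$, then for every assignment of parities to the edges of $H$ there is an embedding of $H$ in $G$ as a topological minor in which the length of every edge embedding has the parity assigned to its edge. -/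

import Mathlib

universe u v

namespace ExpanderEmbedding

open scoped Classical in
/-- The neighbours of `U` that lie outside `U`. -/
noncomputable def outerBoundary {V : Type*} [Fintype V] (G : SimpleGraph V) (U : Finset V) :
    Finset V :=
  Finset.univ.filter fun v => v ∉ U ∧ ∃ u ∈ U, G.Adj u v

/-- `G` has vertex expansion `α`: every set `U` of at most half of the vertices has at least
`α |U|` neighbours outside `U`. -/
def IsExpander {V : Type*} [Fintype V] (G : SimpleGraph V) (α : ℝ) : Prop :=
  ∀ U : Finset V, (U.card : ℝ) ≤ (Fintype.card V : ℝ) / 2 →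
    α * (U.card : ℝ) ≤ ((outerBoundary G U).card : ℝ)

/-- The constant `2 / log (1 + α) + 3`; logarithms are to base two. -/
noncomputable def diamConst (α : ℝ) : ℝ :=
  2 / Real.logb 2 (1 + α) + 3

open scoped Classical in
/-- Every induced subgraph on at least `κ n` of the `n` vertices has maximum degree at least `d`. -/
def IsMaxDegreeRobust {V : Type*} [Fintype V] (G : SimpleGraph V) (κ d : ℝ) : Prop :=
  ∀ U : Finset V, κ * (Fintype.card V : ℝ) ≤ (U.card : ℝ) →
    d ≤ ((G.induce (U : Set V)).maxDegree : ℝ)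

/-- Every induced subgraph on at least `κ n` of the `n` vertices that is an `α`-expander contains
an odd cycle whose length is at least `ℓ` and at most `3 * diamConst (α / 2) * log n`. -/
def IsOddCycleRobust {V : Type*} [Fintype V] (G : SimpleGraph V) (κ α ℓ : ℝ) : Prop :=
  ∀ U : Finset V, κ * (Fintype.card V : ℝ) ≤ (U.card : ℝ) →
    IsExpander (G.induce (U : Set V)) α →
    ∃ (v : (U : Set V)) (c : (G.induce (U : Set V)).Walk v v),
      c.IsCycle ∧ Odd c.length ∧ ℓ ≤ (c.length : ℝ) ∧
      (c.length : ℝ) ≤ 3 * diamConst (α / 2) * Real.logb 2 (Fintype.card V : ℝ)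

/-- An embedding of `H` into `G` as a topological minor: an injection of the vertices of `H` and,
for every edge of `H`, a path of `G` joining the images of its two ends.  No path passes through
the image of a vertex of `H` other than the two ends of its edge, and the paths of two different
edges meet only in images of common ends of the two edges. -/
structure TopologicalMinor {W V : Type*} (H : SimpleGraph W) (G : SimpleGraph V) where
  vertexMap : W → V
  injective : Function.Injective vertexMap
  edgePath : ∀ {u v : W}, H.Adj u v → G.Walk (vertexMap u) (vertexMap v)
  isPath : ∀ {u v : W} (h : H.Adj u v), (edgePath h).IsPath
  /-- There is one path for each undirected edge. -/
  edgePath_symm : ∀ {u v : W} (h : H.Adj u v), edgePath h.symm = (edgePath h).reverse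
  vertex_on_path : ∀ {u v w : W} (h : H.Adj u v),
    vertexMap w ∈ (edgePath h).support → w ∈ s(u, v)
  disjoint : ∀ {u v u' v' : W} (h : H.Adj u v) (h' : H.Adj u' v'), s(u, v) ≠ s(u', v') →
    ∀ x : V, x ∈ (edgePath h).support → x ∈ (edgePath h').support →
      ∃ w : W, w ∈ s(u, v) ∧ w ∈ s(u', v') ∧ x = vertexMap w

end ExpanderEmbedding

/-!
The embedding is built step by step.  At every stage a set `B` of vertices has been discarded,
some vertices of `H` have been placed and some edges of `H` have been embedded; the remaining
vertices of `G` form a set `Y`.  The discarded set has few neighbours in `Y` relative to its size,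
so, as `G` expands and only few vertices are used, `B` stays small and `Y` contains all but a
small part of `G`.

*Placing a vertex.*  A placed vertex `w` of degree `d` owns a star whose number of leaves is of order `d`, and a
set `K w`, grown from the leaves, of `q * s` vertices with `q` of order `d` and `s` of order
`log n`.  It is grown so that every subset `D` of `K w` has at most `s * |∂D|` vertices, where `∂D`
consists of the leaves in `D` and the vertices of `D` with a neighbour in `K w \ D`
(`exists_growth`).  The size of `∂D` is submodular, so the sets attaining the bound are closed
under unions (`exists_largest_tight`); if `K w` could not be enlarged, the largest such set would
exhibit a set of few vertices that separates the leaves from the rest of `Y`.  For each embedded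
edge at `w`, one vertex of `K w` is an attachment vertex, and only the condition of Menger's
theorem for linking the attachment vertices to the leaves is maintained.  By the bound on `K w`, at
most `d * s` vertices of `K w` are unavailable for a further attachment.

*The process.*  If `Y` is not an expander, a set violating expansion is discarded.  Otherwise,
missing vertices are placed at vertices of large degree.  For a missing edge `uv`, let `A` be the
set of available attachment vertices in `K u`.  If `A` has few neighbours in `Y`, then `u` is given
up and `A` is discarded: the vertices freed by giving up `u` are at most of order `d * s`, a small
fraction of `|A|`, so the condition on `B` survives.  Otherwise `u` and `v` are connected through
`Y` by a set of at most `s` vertices.  The process makes progress lexicographically in the numbers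
of discarded vertices, placed vertices and embedded edges, so an extremal partial embedding is
complete (`PartialEmbedding.exists_complete`).  Finally Menger's theorem
(`exists_disjoint_regions`) gives the paths inside the sets `K w`.

*Parities.*  The paths inside the sets `K w` are fixed only at the end, so a connecting set must
offer paths of both parities (`exists_connects_true`).  It consists of an odd cycle and two disjoint
short paths from it to the two sides.  To find these, take a short path from a vertex `t` on the
first side to the cycle, and consider the vertices that, together with `t`, cannot be separated
from the cycle by one vertex within some small set.  Each step of growth loses only one neighbour
of this collection (`card_linkLayer_succ`), so, as the cycle has at least `1 + 2 / β` vertices, it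
grows beyond half of `Y` in logarithmically many steps.  The same holds with the cycle replaced by
`t` and many vertices on the second side.  A common vertex of both collections shows that no single
vertex separates the two sides from the cycle.
-/

namespace ExpanderEmbedding

open scoped Classical

/-! ### Boundaries, robust growth and Menger's theorem -/

section Boundary

variable {V : Type*} (G : SimpleGraph V)

/-- The vertices of `Y` that lie outside `U` and have a neighbour in `U`. -/
noncomputable def nb (Y U : Finset V) : Finset V :=
  (Y \ U).filter fun y => ∃ u ∈ U, G.Adj u y

/-- The boundary of `D` in the set `K` with sources `A`: the vertices of `D` that are sources or
have a neighbour in `K \ D`.  Every walk in `K` from a source to a vertex of `D` meets it. -/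
noncomputable def bd (K A D : Finset V) : Finset V :=
  D.filter fun x => x ∈ A ∨ ∃ y ∈ K \ D, G.Adj x y

variable {G}

theorem mem_nb {Y U : Finset V} {y : V} :
    y ∈ nb G Y U ↔ (y ∈ Y ∧ y ∉ U) ∧ ∃ u ∈ U, G.Adj u y := by
  simp [nb]

theorem mem_bd {K A D : Finset V} {x : V} :
    x ∈ bd G K A D ↔ x ∈ D ∧ (x ∈ A ∨ ∃ y, y ∈ K ∧ y ∉ D ∧ G.Adj x y) := by
  simp [bd, and_assoc]

theorem nb_subset (Y U : Finset V) : nb G Y U ⊆ Y := fun _ hy => (mem_nb.1 hy).1.1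

theorem nb_mono {Y Y' U : Finset V} (h : Y ⊆ Y') : nb G Y U ⊆ nb G Y' U := fun _ hy =>
  mem_nb.2 ⟨⟨h (mem_nb.1 hy).1.1, (mem_nb.1 hy).1.2⟩, (mem_nb.1 hy).2⟩

theorem bd_subset (K A D : Finset V) : bd G K A D ⊆ D := Finset.filter_subset _ _

theorem bd_mono {K K' A D D' : Finset V} (hK : K ⊆ K') (hD : D ⊆ D')
    (h : ∀ y ∈ K, y ∉ D → y ∉ D') : bd G K A D ⊆ bd G K' A D' := by
  intro x hx
  rw [mem_bd] at hx ⊢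
  refine ⟨hD hx.1, hx.2.imp id ?_⟩
  rintro ⟨y, hy, hyD, hxy⟩
  exact ⟨y, hK hy, h y hy hyD, hxy⟩

theorem bd_inter_subset {K K' A D : Finset V} (hK : K ⊆ K') :
    bd G K A (D ∩ K) ⊆ bd G K' A D :=
  bd_mono hK Finset.inter_subset_left fun _ hy hyD h => hyD (Finset.mem_inter.2 ⟨h, hy⟩)

theorem bd_erase_subset {K A D : Finset V} {z : V} (hz : z ∉ K) :
    bd G K A (D.erase z) ⊆ bd G (insert z K) A D :=
  bd_mono (Finset.subset_insert _ _) (Finset.erase_subset _ _) fun _ hy hyD h =>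
    hyD (Finset.mem_erase.2 ⟨fun e => hz (e ▸ hy), h⟩)

/-- The size of the boundary is submodular. -/
theorem card_bd_union_add_card_bd_inter_le (K A D E : Finset V) :
    (bd G K A (D ∪ E)).card + (bd G K A (D ∩ E)).card ≤
      (bd G K A D).card + (bd G K A E).card := by
  rw [← Finset.card_union_add_card_inter, ← Finset.card_union_add_card_inter (bd G K A D)]
  apply add_le_add <;> apply Finset.card_le_card <;> intro x hx <;>
    simp only [Finset.mem_union, Finset.mem_inter, mem_bd] at hx ⊢ <;> grind

/-- A walk inside `K` from a vertex of `D` to a source meets the boundary of `D`. -/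
theorem exists_mem_bd_of_walk {K A D : Finset V} {x a : V} (p : G.Walk x a)
    (hp : ∀ y ∈ p.support, y ∈ K) (hx : x ∈ D) (ha : a ∈ A ∨ a ∉ D) :
    ∃ b ∈ p.support, b ∈ bd G K A D := by
  induction p with
  | nil => exact ⟨_, by simp, mem_bd.2 ⟨hx, Or.inl (by tauto)⟩⟩
  | @cons u v w h p ih =>
    by_cases hv : v ∈ D
    · obtain ⟨b, hb, hb'⟩ := ih (fun y hy => hp y (by simp [hy])) hv ha
      exact ⟨b, by simp [hb], hb'⟩
    · exact ⟨u, by simp, mem_bd.2 ⟨hx, Or.inr ⟨v, hp v (by simp), hv, h⟩⟩⟩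

/-- If a supermodular set function is bounded by `s` times the size of the boundary, then the sets
attaining the bound are closed under unions, hence lie in a largest one. -/
theorem exists_largest_tight {K A : Finset V} {s : ℕ} (g : Finset V → ℕ) (g_empty : g ∅ = 0)
    (hg : ∀ D E, g D + g E ≤ g (D ∪ E) + g (D ∩ E))
    (h : ∀ D ⊆ K, g D ≤ s * (bd G K A D).card) :
    ∃ T ⊆ K, g T = s * (bd G K A T).card ∧
      ∀ D ⊆ K, g D = s * (bd G K A D).card → D ⊆ T := by
  let P := K.powerset.filter fun D => g D = s * (bd G K A D).card
  have hne : P.Nonempty := ⟨∅, by simp [P, g_empty, bd]⟩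
  obtain ⟨T, hT, hmax⟩ := P.exists_max_image Finset.card hne
  have hT' : T ⊆ K ∧ g T = s * (bd G K A T).card := by simpa [P] using hT
  refine ⟨T, hT'.1, hT'.2, fun D hD hDt => ?_⟩
  have hU : T ∪ D ∈ P := by
    have hsub : T ∪ D ⊆ K := Finset.union_subset hT'.1 hD
    have h1 := h _ hsub
    have h2 := h (T ∩ D) (Finset.inter_subset_left.trans hT'.1)
    have h3 := Nat.mul_le_mul_left s (card_bd_union_add_card_bd_inter_le (G := G) K A T D)
    have h4 := hg T D
    simp only [P, Finset.mem_filter, Finset.mem_powerset]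
    refine ⟨hsub, ?_⟩
    rw [mul_add, mul_add] at h3
    omega
  have := Finset.eq_of_subset_of_card_le (Finset.subset_union_left (s₁ := T) (s₂ := D)) (hmax _ hU)
  rw [this]
  exact Finset.subset_union_right

/-- If a set `A` cannot be separated from large sets by fewer than `q` vertices, then it grows to
a set `K` of size `q * s` in which every set of vertices separated from `A` is at most `s` times
as large as its separator.  A set that cannot be enlarged by any vertex outside yields a separator
by taking the largest set attaining the bound. -/
theorem exists_growth {Y A : Finset V} {q s : ℕ} (hs : 1 ≤ s) (hA : A ⊆ Y)
    (hAc : A.card ≤ q * s)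
    (hY : ∀ U ⊆ Y, U.card ≤ q * s → A.card + 1 ≤ U.card + q → q ≤ (nb G Y U).card) :
    ∃ K ⊆ Y, A ⊆ K ∧ K.card = q * s ∧ ∀ D ⊆ K, D.card ≤ s * (bd G K A D).card := by
  let P := Y.powerset.filter fun K => A ⊆ K ∧ K.card ≤ q * s ∧
    ∀ D ⊆ K, D.card ≤ s * (bd G K A D).card
  have hne : P.Nonempty := by
    refine ⟨A, ?_⟩
    simp only [P, Finset.mem_filter, Finset.mem_powerset]
    refine ⟨hA, subset_rfl, hAc, fun D hD => ?_⟩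
    have : bd G A A D = D := by
      ext x; rw [mem_bd]; exact ⟨fun h => h.1, fun h => ⟨h, Or.inl (hD h)⟩⟩
    rw [this]
    exact Nat.le_mul_of_pos_left _ hs
  obtain ⟨K, hK, hmax⟩ := P.exists_max_image Finset.card hne
  simp only [P, Finset.mem_filter, Finset.mem_powerset] at hK hmax
  obtain ⟨hKY, hAK, hKc, hKe⟩ := hK
  refine ⟨K, hKY, hAK, ?_, hKe⟩
  by_contra hlt
  replace hlt : K.card < q * s := lt_of_le_of_ne hKc hlt
  obtain ⟨T, hTK, hTt, hTmax⟩ := exists_largest_tight (G := G) (K := K) (A := A) (s := s)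
    Finset.card (by simp) (fun D E => (Finset.card_union_add_card_inter D E).ge) hKe
  -- every neighbour of `K` in `Y \ K` has all its neighbours in `K` inside `T`
  have key : ∀ z ∈ Y, z ∉ K → ∀ x ∈ K, G.Adj x z → x ∈ T := by
    intro z hzY hzK x hxK hxz
    by_contra hxT
    have hbad : insert z K ∈ P := by
      simp only [P, Finset.mem_filter, Finset.mem_powerset]
      refine ⟨Finset.insert_subset hzY hKY, hAK.trans (Finset.subset_insert _ _), ?_, ?_⟩
      · rw [Finset.card_insert_of_notMem hzK]; omega
      intro D hD
      have hD0 : D.erase z ⊆ K := by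
        intro y hy
        have := hD (Finset.mem_of_mem_erase hy)
        exact (Finset.mem_insert.1 this).resolve_left (Finset.ne_of_mem_erase hy)
      have hsub := bd_erase_subset (G := G) (A := A) (D := D) hzK
      by_cases hzD : z ∈ D
      · have hc : D.card = (D.erase z).card + 1 := by
          rw [Finset.card_erase_of_mem hzD]
          have := Finset.card_pos.2 ⟨z, hzD⟩
          omega
        have h0 := hKe _ hD0
        by_cases ht : (D.erase z).card = s * (bd G K A (D.erase z)).card
        · have hxD : x ∉ D := fun h => hxT (hTmax _ hD0 ht
            (Finset.mem_erase.2 ⟨fun e => hzK (e ▸ hxK), h⟩))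
          have hz : z ∈ bd G (insert z K) A D :=
            mem_bd.2 ⟨hzD, Or.inr ⟨x, Finset.mem_insert_of_mem hxK, hxD, hxz.symm⟩⟩
          have hz' : z ∉ bd G K A (D.erase z) := fun h =>
            hzK (hD0 (bd_subset _ _ _ h))
          have := Finset.card_le_card (Finset.insert_subset hz hsub)
          rw [Finset.card_insert_of_notMem hz'] at this
          have := Nat.mul_le_mul_left s this
          rw [mul_add] at this
          omega
        · have := Nat.mul_le_mul_left s (Finset.card_le_card hsub)
          omega
      · rw [Finset.erase_eq_of_notMem hzD] at hsub hD0
        exact (hKe D hD0).trans (Nat.mul_le_mul_left s (Finset.card_le_card hsub))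
    have hle := hmax (insert z K) (by simpa [P] using hbad)
    rw [Finset.card_insert_of_notMem hzK] at hle
    omega
  have hTq : (bd G K A T).card < q := by
    have h1 : s * (bd G K A T).card < s * q := by
      rw [← hTt, mul_comm s q]
      exact (Finset.card_le_card hTK).trans_lt hlt
    exact lt_of_mul_lt_mul_left h1 (Nat.zero_le _)
  have hnb : nb G Y (K \ T) ⊆ bd G K A T := by
    intro y hy
    obtain ⟨⟨hyY, hyU⟩, u, hu, huy⟩ := mem_nb.1 hy
    rw [Finset.mem_sdiff] at hu
    by_cases hyK : y ∈ K
    · have hyT : y ∈ T := by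
        by_contra h; exact hyU (Finset.mem_sdiff.2 ⟨hyK, h⟩)
      exact mem_bd.2 ⟨hyT, Or.inr ⟨u, hu.1, hu.2, huy.symm⟩⟩
    · exact absurd (key y hyY hyK u hu.1 huy) hu.2
  have hA' : A ⊆ (K \ T) ∪ bd G K A T := by
    intro a ha
    by_cases haT : a ∈ T
    · exact Finset.mem_union_right _ (mem_bd.2 ⟨haT, Or.inl ha⟩)
    · exact Finset.mem_union_left _ (Finset.mem_sdiff.2 ⟨hAK ha, haT⟩)
  have h1 := (Finset.card_le_card hA').trans (Finset.card_union_le _ _)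
  have h2 := hY (K \ T) (Finset.sdiff_subset.trans hKY)
    ((Finset.card_le_card Finset.sdiff_subset).trans hKc) (by omega)
  have h3 := Finset.card_le_card hnb
  omega

/-- **Menger's theorem**, in the form used here: if every `D ⊆ K` contains at most as many
vertices of `T` as its boundary has, then the vertices of `T` are reached from `A` inside disjoint
subsets of `K`.  By induction on `K`: a vertex `t ∈ T \ A` is deleted and replaced by a neighbour
for which the hypothesis survives. -/
theorem exists_disjoint_regions {K A T : Finset V} (hTK : T ⊆ K)
    (h : ∀ D ⊆ K, (T ∩ D).card ≤ (bd G K A D).card) :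
    ∃ F : V → Finset V, (∀ t ∈ T, F t ⊆ K) ∧
      (∀ t ∈ T, ∃ a ∈ A, ∃ p : G.Walk a t, ∀ x ∈ p.support, x ∈ F t) ∧
      ∀ t ∈ T, ∀ t' ∈ T, t ≠ t' → Disjoint (F t) (F t') := by
  induction hn : K.card generalizing K T with
  | zero =>
    have : T = ∅ := Finset.subset_empty.1 (Finset.card_eq_zero.1 hn ▸ hTK)
    exact ⟨fun _ => ∅, by simp [this]⟩
  | succ n ih =>
    by_cases hTA : T ⊆ A
    · refine ⟨fun t => {t}, ?_, ?_, ?_⟩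
      · intro t ht; simpa using hTK ht
      · intro t ht; exact ⟨t, hTA ht, .nil, by simp⟩
      · intro t _ t' _ hne; simpa using hne
    obtain ⟨t, htT, htA⟩ := Finset.not_subset.1 hTA
    have htK := hTK htT
    set K' := K.erase t with hK'
    set T' := T.erase t with hT'
    have hT'K' : T' ⊆ K' := Finset.erase_subset_erase _ hTK
    have hcard : K'.card = n := by rw [hK', Finset.card_erase_of_mem htK]; omega
    have htt : T.card = T'.card + 1 := by
      rw [hT', Finset.card_erase_of_mem htT]
      have := Finset.card_pos.2 ⟨t, htT⟩
      omega
    -- deleting `t` costs at most one boundary vertex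
    have h' : ∀ D ⊆ K', (T' ∩ D).card ≤ 1 * (bd G K' A D).card := by
      intro D hD
      have htD : t ∉ D := fun h => by simpa [hK'] using hD h
      have h1 := h (insert t D)
        (Finset.insert_subset htK (hD.trans (Finset.erase_subset _ _)))
      have h2 : bd G K A (insert t D) ⊆ insert t (bd G K' A D) := by
        intro x hx
        rw [mem_bd] at hx
        rcases Finset.mem_insert.1 hx.1 with rfl | hxD
        · simp
        · refine Finset.mem_insert_of_mem (mem_bd.2 ⟨hxD, hx.2.imp id ?_⟩)
          rintro ⟨y, hy, hyD, hxy⟩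
          rw [Finset.mem_insert, not_or] at hyD
          exact ⟨y, Finset.mem_erase.2 ⟨hyD.1, hy⟩, hyD.2, hxy⟩
      have h3 := (Finset.card_le_card h2).trans (Finset.card_insert_le _ _)
      have h4 : insert t (T' ∩ D) ⊆ T ∩ insert t D := by
        intro x hx
        rcases Finset.mem_insert.1 hx with rfl | hx
        · simp [htT]
        · rw [Finset.mem_inter] at hx
          simp [Finset.mem_of_mem_erase hx.1, hx.2]
      have h5 := Finset.card_le_card h4
      rw [Finset.card_insert_of_notMem (by simp [htD])] at h5
      omega
    obtain ⟨S, hSK, hSt, hSmax⟩ := exists_largest_tight (G := G) (K := K') (A := A) (s := 1)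
      (fun D => (T' ∩ D).card) (by simp)
      (fun D E => by
        rw [Finset.inter_union_distrib_left, Finset.inter_inter_distrib_left]
        exact (Finset.card_union_add_card_inter _ _).ge) h'
    obtain ⟨r, hrK, htr, hrT, hrS⟩ : ∃ r ∈ K', G.Adj r t ∧ r ∉ T' ∧ r ∉ S := by
      by_contra hcon
      push Not at hcon
      have h1 := h (insert t (S ∪ T')) (Finset.insert_subset htK
        ((Finset.union_subset hSK hT'K').trans (Finset.erase_subset _ _)))
      have h2 : T ⊆ T ∩ insert t (S ∪ T') := by
        intro x hx
        by_cases hxt : x = t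
        · simp [htT, hxt]
        · simp [hx, hT', hxt]
      have h3 : bd G K A (insert t (S ∪ T')) ⊆ bd G K' A S ∪ (T' \ S) := by
        intro x hx
        rw [mem_bd] at hx
        obtain ⟨hx1, hx2⟩ := hx
        have hxt : x ≠ t := by
          rintro rfl
          rcases hx2 with hxA | ⟨y, hy, hyD, hxy⟩
          · exact htA hxA
          · simp only [Finset.mem_insert, Finset.mem_union, not_or] at hyD
            exact hyD.2.1 (hcon y (Finset.mem_erase.2 ⟨hyD.1, hy⟩) hxy.symm hyD.2.2)
        by_cases hxS : x ∈ S
        · refine Finset.mem_union_left _ (mem_bd.2 ⟨hxS, hx2.imp id ?_⟩)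
          rintro ⟨y, hy, hyD, hxy⟩
          simp only [Finset.mem_insert, Finset.mem_union, not_or] at hyD
          exact ⟨y, Finset.mem_erase.2 ⟨hyD.1, hy⟩, hyD.2.1, hxy⟩
        · simp only [Finset.mem_insert, Finset.mem_union, hxt, hxS, false_or] at hx1
          exact Finset.mem_union_right _ (Finset.mem_sdiff.2 ⟨hx1, hxS⟩)
      have h4 := (Finset.card_le_card h3).trans (Finset.card_union_le _ _)
      have h5 := Finset.card_le_card h2
      have h6 := Finset.card_inter_add_card_sdiff T' S
      omega
    have hT''K : insert r T' ⊆ K' := Finset.insert_subset hrK hT'K'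
    obtain ⟨F, hF1, hF2, hF3⟩ := ih hT''K (fun D hD => by
      have h1 := h' D hD
      by_cases hrD : r ∈ D
      · have h2 : (T' ∩ D).card ≠ 1 * (bd G K' A D).card := fun e => hrS (hSmax D hD e hrD)
        rw [Finset.insert_inter_of_mem hrD]
        have := Finset.card_insert_le r (T' ∩ D)
        omega
      · rw [Finset.insert_inter_of_notMem hrD]; omega) hcard
    have hF1' : ∀ x ∈ insert r T', t ∉ F x := fun x hx hm => by
      simpa [hK'] using hF1 x hx hm
    have hmem : ∀ x ∈ T, x ≠ t → x ∈ insert r T' ∧ x ≠ r := fun x hx hxt => by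
      have : x ∈ T' := Finset.mem_erase.2 ⟨hxt, hx⟩
      exact ⟨Finset.mem_insert_of_mem this, fun e => hrT (e ▸ this)⟩
    have hr : r ∈ insert r T' := Finset.mem_insert_self _ _
    refine ⟨fun x => if x = t then insert t (F r) else F x, ?_, ?_, ?_⟩
    · intro x hx
      by_cases hxt : x = t
      · simp only [hxt, if_true]
        exact Finset.insert_subset htK ((hF1 r hr).trans (Finset.erase_subset _ _))
      · simp only [hxt, if_false]
        exact (hF1 x (hmem x hx hxt).1).trans (Finset.erase_subset _ _)
    · intro x hx
      by_cases hxt : x = t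
      · subst hxt
        obtain ⟨a, ha, p, hp⟩ := hF2 r hr
        refine ⟨a, ha, p.concat htr, fun y hy => ?_⟩
        simp only [if_true]
        rw [SimpleGraph.Walk.support_concat] at hy
        simp only [List.mem_append, List.mem_singleton] at hy
        rcases hy with hy | rfl
        · exact Finset.mem_insert_of_mem (hp y hy)
        · exact Finset.mem_insert_self _ _
      · simp only [hxt, if_false]
        exact hF2 x (hmem x hx hxt).1
    · intro x hx y hy hxy
      by_cases hxt : x = t <;> by_cases hyt : y = t
      · exact absurd (hxt.trans hyt.symm) hxy
      · simp only [hxt, hyt, if_true, if_false]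
        have := hmem y hy hyt
        rw [Finset.disjoint_insert_left]
        exact ⟨hF1' y this.1, hF3 r hr y this.1 this.2.symm⟩
      · simp only [hxt, hyt, if_true, if_false]
        have := hmem x hx hxt
        rw [Finset.disjoint_insert_right]
        exact ⟨hF1' x this.1, hF3 x this.1 r hr this.2⟩
      · simp only [hxt, hyt, if_false]
        exact hF3 x (hmem x hx hxt).1 y (hmem y hy hyt).1 hxy

end Boundary

/-! ### Expansion inside a vertex set and walks -/

section Expansion

variable {V : Type*} {G : SimpleGraph V}

/-- The graph induced on the set `Y` of vertices is a `β`-expander. -/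
def ExpandsIn (G : SimpleGraph V) (Y : Finset V) (β : ℝ) : Prop :=
  ∀ U ⊆ Y, 2 * U.card ≤ Y.card → β * U.card ≤ (nb G Y U).card

theorem expandsIn_iff_isExpander_induce [Fintype V] {Y : Finset V} {β : ℝ} :
    ExpandsIn G Y β ↔ IsExpander (G.induce (Y : Set V)) β := by
  have hb : ∀ U : Finset (Y : Set V),
      (outerBoundary (G.induce (Y : Set V)) U).map (Function.Embedding.subtype _) =
        nb G Y (U.map (Function.Embedding.subtype _)) := by
    intro U
    ext x
    simp only [outerBoundary, Finset.mem_map, Finset.mem_filter, Finset.mem_univ, true_and, mem_nb,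
      Function.Embedding.coe_subtype, SimpleGraph.comap_adj]
    constructor
    · rintro ⟨x, ⟨hx, u, hu, hux⟩, rfl⟩
      refine ⟨⟨x.2, ?_⟩, u, ⟨u, hu, rfl⟩, hux⟩
      rintro ⟨x', hx', h⟩
      exact hx (Subtype.ext h ▸ hx')
    · rintro ⟨⟨hx, hxU⟩, _, ⟨u, hu, rfl⟩, hux⟩
      exact ⟨⟨x, hx⟩, ⟨fun h => hxU ⟨_, h, rfl⟩, u, hu, hux⟩, rfl⟩
  have hc : Fintype.card (Y : Set V) = Y.card := by simp
  constructor
  · intro h U hU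
    have h2 : U.map (Function.Embedding.subtype _) ⊆ Y := by
      intro x hx
      obtain ⟨y, -, rfl⟩ := Finset.mem_map.1 hx
      exact y.2
    have := h _ h2 (by
      rw [Finset.card_map]
      rw [hc, le_div_iff₀ two_pos] at hU
      have : ((2 * U.card : ℕ) : ℝ) ≤ Y.card := by push_cast; linarith
      exact_mod_cast this)
    rwa [← hb, Finset.card_map, Finset.card_map] at this
  · intro h U hU hc2
    have hUe : (U.subtype (· ∈ (Y : Set V))).map (Function.Embedding.subtype _) = U := by
      rw [Finset.subtype_map_of_mem]
      exact fun x hx => hU hx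
    have := h (U.subtype (· ∈ (Y : Set V))) (by
      rw [← Finset.card_map (Function.Embedding.subtype _), hUe, hc, le_div_iff₀ two_pos]
      exact_mod_cast (by omega))
    rwa [← Finset.card_map (Function.Embedding.subtype _), hUe,
      ← Finset.card_map (Function.Embedding.subtype _), hb, hUe] at this

/-- A sequence that grows geometrically as long as it is at most half of `m` exceeds half of `m`
within the number of steps that geometric growth needs to reach `m`. -/
theorem exists_half_lt_of_growth {a : ℕ → ℕ} {δ : ℝ} {m N : ℕ} (hδ : 0 < δ) (h0 : 1 ≤ a 0)
    (h : ∀ i, 2 * a i ≤ m → (1 + δ) * a i ≤ a (i + 1)) (hN : (m : ℝ) < (1 + δ) ^ N) :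
    ∃ i ≤ N, m < 2 * a i := by
  by_contra! hcon
  have key : ∀ i ≤ N, (1 + δ) ^ i ≤ a i := by
    intro i
    induction i with
    | zero => intro _; simpa using h0
    | succ i ih =>
      intro hi
      have h1 := ih (by omega)
      have h2 := h i (hcon i (by omega))
      rw [pow_succ]
      nlinarith
  have h1 := key N le_rfl
  have h2 : ((2 * a N : ℕ) : ℝ) ≤ m := by exact_mod_cast hcon N le_rfl
  push_cast at h2
  have : (0 : ℝ) ≤ a N := Nat.cast_nonneg _
  linarith

/-- The vertices within distance `i` of `U` in the graph induced on `Y`. -/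
noncomputable def ball (G : SimpleGraph V) (Y U : Finset V) : ℕ → Finset V
  | 0 => U
  | i + 1 => ball G Y U i ∪ nb G Y (ball G Y U i)

theorem ball_subset {Y U : Finset V} (hU : U ⊆ Y) (i : ℕ) : ball G Y U i ⊆ Y := by
  induction i with
  | zero => exact hU
  | succ i ih => exact Finset.union_subset ih (nb_subset _ _)

theorem exists_walk_of_mem_ball {Y U : Finset V} (hU : U ⊆ Y) (i : ℕ) {z : V}
    (hz : z ∈ ball G Y U i) :
    ∃ x ∈ U, ∃ p : G.Walk x z, (∀ y ∈ p.support, y ∈ Y) ∧ p.length ≤ i := by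
  induction i generalizing z with
  | zero => exact ⟨z, hz, .nil, by simpa using hU hz, le_rfl⟩
  | succ i ih =>
    rcases Finset.mem_union.1 hz with hz | hz
    · obtain ⟨x, hx, p, hp, hl⟩ := ih hz
      exact ⟨x, hx, p, hp, by omega⟩
    · obtain ⟨⟨hzY, -⟩, u, hu, huz⟩ := mem_nb.1 hz
      obtain ⟨x, hx, p, hp, hl⟩ := ih hu
      refine ⟨x, hx, p.concat huz, ?_, by simp; omega⟩
      intro y hy
      simp only [SimpleGraph.Walk.support_concat, List.mem_append, List.mem_singleton] at hy
      rcases hy with hy | rfl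
      · exact hp y hy
      · exact hzY

theorem exists_half_lt_card_ball {Y U : Finset V} {β : ℝ} {N : ℕ} (hβ : 0 < β)
    (hY : ExpandsIn G Y β) (hN : (Y.card : ℝ) < (1 + β) ^ N) (hU : U ⊆ Y) (hne : U.Nonempty) :
    ∃ i ≤ N, Y.card < 2 * (ball G Y U i).card := by
  refine exists_half_lt_of_growth hβ (Finset.card_pos.2 hne) (fun i hi => ?_) hN
  have h1 := hY _ (ball_subset hU i) hi
  have h2 : (ball G Y U (i + 1)).card = (ball G Y U i).card + (nb G Y (ball G Y U i)).card := by
    rw [ball, Finset.card_union_of_disjoint]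
    exact Finset.disjoint_left.2 fun x hx hx' => (mem_nb.1 hx').1.2 hx
  rw [h2]
  push_cast
  linarith

theorem exists_mem_inter_of_half_lt {Y S T : Finset V} (hS : S ⊆ Y) (hT : T ⊆ Y)
    (h1 : Y.card < 2 * S.card) (h2 : Y.card < 2 * T.card) : ∃ z, z ∈ S ∧ z ∈ T := by
  by_contra! h
  have hd : Disjoint S T := Finset.disjoint_left.2 fun x hx => h x hx
  have := Finset.card_le_card (Finset.union_subset hS hT)
  rw [Finset.card_union_of_disjoint hd] at this
  omega

/-- Two nonempty sets of vertices of an expander are joined by a walk of logarithmic length. -/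
theorem exists_short_walk {Y A B : Finset V} {β : ℝ} {N : ℕ} (hβ : 0 < β)
    (hY : ExpandsIn G Y β) (hN : (Y.card : ℝ) < (1 + β) ^ N) (hA : A ⊆ Y) (hB : B ⊆ Y)
    (hAne : A.Nonempty) (hBne : B.Nonempty) :
    ∃ a ∈ A, ∃ b ∈ B, ∃ p : G.Walk a b, (∀ y ∈ p.support, y ∈ Y) ∧ p.length ≤ 2 * N := by
  obtain ⟨i, hi, h1⟩ := exists_half_lt_card_ball hβ hY hN hA hAne
  obtain ⟨j, hj, h2⟩ := exists_half_lt_card_ball hβ hY hN hB hBne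
  obtain ⟨z, hz1, hz2⟩ := exists_mem_inter_of_half_lt (ball_subset hA i) (ball_subset hB j) h1 h2
  obtain ⟨a, ha, p, hp, hpl⟩ := exists_walk_of_mem_ball hA i hz1
  obtain ⟨b, hb, q, hq, hql⟩ := exists_walk_of_mem_ball hB j hz2
  refine ⟨a, ha, b, hb, p.append q.reverse, ?_, by simp; omega⟩
  intro y hy
  rw [SimpleGraph.Walk.mem_support_append_iff] at hy
  rcases hy with hy | hy
  · exact hp y hy
  · exact hq y (by simpa using hy)

end Expansion

section Walks

variable {V : Type*} {G : SimpleGraph V}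

theorem isPath_append {u v w : V} {p : G.Walk u v} {q : G.Walk v w} (hp : p.IsPath)
    (hq : q.IsPath) (h : ∀ x ∈ p.support, x ∈ q.support → x = v) : (p.append q).IsPath := by
  induction p with
  | nil => simpa using hq
  | @cons a b c hab p ih =>
    rw [SimpleGraph.Walk.cons_isPath_iff] at hp
    rw [SimpleGraph.Walk.cons_append, SimpleGraph.Walk.cons_isPath_iff]
    refine ⟨ih hp.1 hq fun x hx => h x (by simp [hx]), ?_⟩
    rw [SimpleGraph.Walk.mem_support_append_iff]
    rintro (h' | h')
    · exact hp.2 h'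
    · exact hp.2 (h a (by simp) h' ▸ p.end_mem_support)

/-- The last part of a walk that visits `C` is a path leaving `C` at its first vertex. -/
theorem exists_path_from_last {C F : Finset V} {x t : V} (p : G.Walk x t)
    (hp : ∀ y ∈ p.support, y ∈ F) (hC : ∃ y ∈ p.support, y ∈ C) :
    ∃ a ∈ C, ∃ q : G.Walk a t, q.IsPath ∧ (∀ y ∈ q.support, y ∈ F) ∧
      ∀ y ∈ q.support, y ∈ C → y = a := by
  induction p with
  | @nil u =>
    obtain ⟨y, hy, hyC⟩ := hC
    simp only [SimpleGraph.Walk.support_nil, List.mem_singleton] at hy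
    subst hy
    exact ⟨_, hyC, .nil, by simp, hp, by simp⟩
  | @cons u v w h p ih =>
    by_cases hC' : ∃ y ∈ p.support, y ∈ C
    · exact ih (fun y hy => hp y (by simp [hy])) hC'
    · push Not at hC'
      obtain ⟨y, hy, hyC⟩ := hC
      have hu : u ∈ C := by
        rw [SimpleGraph.Walk.support_cons, List.mem_cons] at hy
        rcases hy with rfl | hy
        · exact hyC
        · exact absurd hyC (hC' y hy)
      refine ⟨u, hu, (SimpleGraph.Walk.cons h p).bypass, SimpleGraph.Walk.bypass_isPath _,
        fun y hy => hp y (SimpleGraph.Walk.support_bypass_subset_support _ hy), ?_⟩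
      intro y hy hyC
      have := SimpleGraph.Walk.support_bypass_subset_support _ hy
      rw [SimpleGraph.Walk.support_cons, List.mem_cons] at this
      exact this.resolve_right fun h => hC' y h hyC

/-- Two distinct vertices of an odd cycle are joined along the cycle by paths of both parities. -/
theorem exists_arc_of_parity {v a b : V} {c : G.Walk v v} (hc : c.IsCycle) (hodd : Odd c.length)
    (ha : a ∈ c.support) (hb : b ∈ c.support) (hab : a ≠ b) (o : Prop) :
    ∃ p : G.Walk a b, p.IsPath ∧ (∀ x ∈ p.support, x ∈ c.support) ∧ (Odd p.length ↔ o) := by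
  have hc' : (c.rotate a ha).IsCycle := by simpa using hc
  have hb' : b ∈ (c.rotate a ha).support := by
    rw [SimpleGraph.Walk.mem_support_rotate_iff]; exact hb
  have hlen : (c.rotate a ha).length = c.length := by simp
  have hsup : ∀ x ∈ (c.rotate a ha).support, x ∈ c.support := fun x hx => by
    rwa [SimpleGraph.Walk.mem_support_rotate_iff] at hx
  generalize c.rotate a ha = d at hc' hb' hlen hsup
  have hspec := d.take_spec hb'
  have hsum : (d.takeUntil b hb').length + (d.dropUntil b hb').length = c.length := by
    rw [← hlen, ← SimpleGraph.Walk.length_append, hspec]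
  have hdrop : (d.dropUntil b hb').IsPath := by
    rw [← hspec] at hc'
    refine hc'.isPath_of_append_right ?_
    intro h
    exact hab h.eq
  by_cases ho : (Odd (d.takeUntil b hb').length ↔ o)
  · exact ⟨_, hc'.isPath_takeUntil hb',
      fun x hx => hsup x (d.support_takeUntil_subset_support hb' hx), ho⟩
  · refine ⟨(d.dropUntil b hb').reverse, hdrop.reverse, fun x hx => hsup x
      (d.support_dropUntil_subset_support hb' (by simpa using hx)), ?_⟩
    rw [SimpleGraph.Walk.length_reverse]
    rw [← hsum, Nat.odd_add] at hodd
    rw [← Nat.not_odd_iff_even] at hodd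
    tauto

theorem card_support_toFinset_le {u v : V} (p : G.Walk u v) :
    p.support.toFinset.card ≤ p.length + 1 := by
  simpa using p.support.toFinset_card_le

theorem card_support_toFinset_of_isCycle {v : V} {c : G.Walk v v} (hc : c.IsCycle) :
    c.support.toFinset.card = c.length := by
  have h : c.support.toFinset = c.support.tail.toFinset := by
    ext x
    simp only [List.mem_toFinset]
    rw [c.mem_support_iff]
    refine ⟨?_, Or.inr⟩
    rintro (rfl | h)
    · exact SimpleGraph.Walk.end_mem_tail_support hc.not_nil
    · exact h
  rw [h, List.toFinset_card_of_nodup hc.support_nodup]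
  simp

end Walks

section TwoLinked

variable {V : Type*} {G : SimpleGraph V}

/-- In the set `K`, no single vertex separates both `t` and `z` from the sources `A`. -/
def TwoLinked (G : SimpleGraph V) (K A : Finset V) (t z : V) : Prop :=
  z ∈ K ∧ ∀ D ⊆ K, t ∈ D → z ∈ D → 2 ≤ (bd G K A D).card

/-- The vertices `z ∈ Y` that, together with `t`, cannot be separated from `A` by one vertex in
some set that arises from `K₀` by adding at most `i` vertices of `Y`. -/
noncomputable def linkLayer (G : SimpleGraph V) (Y A K₀ : Finset V) (t : V) (i : ℕ) : Finset V :=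
  Y.filter fun z => ∃ K, K₀ ⊆ K ∧ K ⊆ K₀ ∪ Y ∧ K.card ≤ K₀.card + i ∧ TwoLinked G K A t z

theorem mem_linkLayer {Y A K₀ : Finset V} {t z : V} {i : ℕ} :
    z ∈ linkLayer G Y A K₀ t i ↔
      z ∈ Y ∧ ∃ K, K₀ ⊆ K ∧ K ⊆ K₀ ∪ Y ∧ K.card ≤ K₀.card + i ∧ TwoLinked G K A t z := by
  simp [linkLayer]

theorem linkLayer_subset (Y A K₀ : Finset V) (t : V) (i : ℕ) : linkLayer G Y A K₀ t i ⊆ Y :=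
  Finset.filter_subset _ _

theorem linkLayer_mono {Y A K₀ : Finset V} {t : V} {i j : ℕ} (h : i ≤ j) :
    linkLayer G Y A K₀ t i ⊆ linkLayer G Y A K₀ t j := by
  intro z hz
  obtain ⟨hzY, K, h1, h2, h3, h4⟩ := mem_linkLayer.1 hz
  exact mem_linkLayer.2 ⟨hzY, K, h1, h2, by omega, h4⟩

theorem bd_nonempty_of_subset {K₀ K A D : Finset V} {t : V} (ht : t ∈ K₀)
    (hK₀ : ∀ D ⊆ K₀, t ∈ D → (bd G K₀ A D).Nonempty) (hK : K₀ ⊆ K) (htD : t ∈ D) :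
    (bd G K A D).Nonempty :=
  (hK₀ (D ∩ K₀) Finset.inter_subset_right (Finset.mem_inter.2 ⟨htD, ht⟩)).mono
    (bd_inter_subset hK)

theorem card_bd_union_le_one {K₀ K A D E : Finset V} {t : V} (ht : t ∈ K₀)
    (hK₀ : ∀ D ⊆ K₀, t ∈ D → (bd G K₀ A D).Nonempty) (hK : K₀ ⊆ K) (htD : t ∈ D) (htE : t ∈ E)
    (hD : (bd G K A D).card ≤ 1) (hE : (bd G K A E).card ≤ 1) :
    (bd G K A (D ∪ E)).card ≤ 1 := by
  have h1 := card_bd_union_add_card_bd_inter_le (G := G) K A D E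
  have h2 := Finset.card_pos.2
    (bd_nonempty_of_subset ht hK₀ hK (Finset.mem_inter.2 ⟨htD, htE⟩))
  omega

theorem card_sources_le_linkLayer {Y A K₀ : Finset V} {t : V} (hA : A ⊆ K₀) (ht : t ∈ K₀)
    (hK₀ : ∀ D ⊆ K₀, t ∈ D → (bd G K₀ A D).Nonempty) :
    (A ∩ Y).card ≤ (linkLayer G Y A K₀ t 0).card + 1 := by
  have h1 : ((A ∩ Y) \ linkLayer G Y A K₀ t 0).card ≤ 1 := by
    have hbad : ∀ a ∈ (A ∩ Y) \ linkLayer G Y A K₀ t 0,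
        a ∈ A ∧ ∃ D ⊆ K₀, t ∈ D ∧ a ∈ D ∧ (bd G K₀ A D).card ≤ 1 := by
      intro a ha
      simp only [Finset.mem_sdiff, Finset.mem_inter] at ha
      obtain ⟨⟨haA, haY⟩, ha⟩ := ha
      refine ⟨haA, ?_⟩
      by_contra! hcon
      refine ha (mem_linkLayer.2 ⟨haY, K₀, subset_rfl, Finset.subset_union_left, le_rfl, hA haA, ?_⟩)
      intro D hD htD haD
      exact hcon D hD htD haD
    rw [Finset.card_le_one]
    intro a ha b hb
    obtain ⟨haA, D, hD, htD, haD, hDc⟩ := hbad a ha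
    obtain ⟨hbA, E, hE, htE, hbE, hEc⟩ := hbad b hb
    have := card_bd_union_le_one ht hK₀ subset_rfl htD htE hDc hEc
    rw [Finset.card_le_one] at this
    exact this a (mem_bd.2 ⟨Finset.mem_union_left _ haD, Or.inl haA⟩) b
      (mem_bd.2 ⟨Finset.mem_union_right _ hbE, Or.inl hbA⟩)
  have h2 := Finset.card_le_card_sdiff_add_card (t := linkLayer G Y A K₀ t 0) (s := A ∩ Y)
  omega

/-- All neighbours of a layer but one belong to the next layer.  A neighbour `y` of `z` that is
not in the next layer is the only boundary vertex of a set containing `t` and `y`.  For two such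
vertices, a boundary vertex of the union of the two sets is the boundary vertex of both, so the two
vertices agree. -/
theorem card_linkLayer_succ {Y A K₀ : Finset V} {t : V} (ht : t ∈ K₀) (htY : t ∉ Y)
    (hK₀ : ∀ D ⊆ K₀, t ∈ D → (bd G K₀ A D).Nonempty) (i : ℕ) :
    (linkLayer G Y A K₀ t i).card + (nb G Y (linkLayer G Y A K₀ t i)).card ≤
      (linkLayer G Y A K₀ t (i + 1)).card + 1 := by
  set S := linkLayer G Y A K₀ t i with hS
  set S' := linkLayer G Y A K₀ t (i + 1) with hS'
  have hbad : ∀ y ∈ nb G Y S \ S', ∃ K, K₀ ⊆ K ∧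
      (∃ D ⊆ K, t ∈ D ∧ y ∈ D ∧ bd G K A D = {y}) ∧
      ∀ x ∈ nb G Y S \ S', x ∈ K₀ → ∃ E ⊆ K, t ∈ E ∧ x ∈ E ∧ (bd G K A E).card ≤ 1 ∧
        (∀ D ⊆ K, t ∈ D → y ∈ D → (bd G K A D).card ≤ 1 → bd G K A D = {y}) := by
    intro y hy
    rw [Finset.mem_sdiff, mem_nb] at hy
    obtain ⟨⟨⟨hyY, hyS⟩, z, hz, hzy⟩, hyS'⟩ := hy
    obtain ⟨hzY, K, hK1, hK2, hK3, hzK, hzg⟩ := mem_linkLayer.1 hz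
    have hyK : y ∈ K := by
      by_contra hyK
      refine hyS' (mem_linkLayer.2 ⟨hyY, insert y K, hK1.trans (Finset.subset_insert _ _),
        Finset.insert_subset (Finset.mem_union_right _ hyY) hK2, ?_, Finset.mem_insert_self _ _, ?_⟩)
      · rw [Finset.card_insert_of_notMem hyK]; omega
      intro D hD htD hyD
      have hty : t ≠ y := fun e => htY (e ▸ hyY)
      have hsub := bd_erase_subset (G := G) (A := A) (D := D) hyK
      have hD0 : D.erase y ⊆ K := by
        intro x hx
        exact (Finset.mem_insert.1 (hD (Finset.mem_of_mem_erase hx))).resolve_left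
          (Finset.ne_of_mem_erase hx)
      have htD0 : t ∈ D.erase y := Finset.mem_erase.2 ⟨hty, htD⟩
      by_cases hzD : z ∈ D
      · exact (hzg _ hD0 htD0 (Finset.mem_erase.2 ⟨fun e => hyK (e ▸ hzK), hzD⟩)).trans
          (Finset.card_le_card hsub)
      · have h1 : y ∈ bd G (insert y K) A D :=
          mem_bd.2 ⟨hyD, Or.inr ⟨z, Finset.mem_insert_of_mem hzK, hzD, hzy.symm⟩⟩
        have h2 : y ∉ bd G K A (D.erase y) := fun h => by
          simpa using bd_subset _ _ _ h
        have h3 := Finset.card_le_card (Finset.insert_subset h1 hsub)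
        rw [Finset.card_insert_of_notMem h2] at h3
        have := Finset.card_pos.2 (bd_nonempty_of_subset ht hK₀ hK1 htD0)
        omega
    have hex : ∀ x ∈ Y, x ∉ S → x ∈ K → ∃ D ⊆ K, t ∈ D ∧ x ∈ D ∧ (bd G K A D).card ≤ 1 := by
      intro x hxY hxS hxK
      by_contra! hcon
      exact hxS (mem_linkLayer.2 ⟨hxY, K, hK1, hK2, hK3, hxK, fun D hD htD hxD =>
        hcon D hD htD hxD⟩)
    have huniq : ∀ D ⊆ K, t ∈ D → y ∈ D → (bd G K A D).card ≤ 1 → bd G K A D = {y} := by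
      intro D hD htD hyD hDc
      have hzD : z ∉ D := fun h => by have := hzg D hD htD h; omega
      have hyb : y ∈ bd G K A D := mem_bd.2 ⟨hyD, Or.inr ⟨z, hzK, hzD, hzy.symm⟩⟩
      refine (Finset.eq_of_subset_of_card_le (Finset.singleton_subset_iff.2 hyb) ?_).symm
      simpa using hDc
    obtain ⟨D, hD, htD, hyD, hDc⟩ := hex y hyY hyS hyK
    refine ⟨K, hK1, ⟨D, hD, htD, hyD, huniq D hD htD hyD hDc⟩, ?_⟩
    intro x hx hxK₀
    rw [Finset.mem_sdiff, mem_nb] at hx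
    obtain ⟨E, hE, htE, hxE, hEc⟩ := hex x hx.1.1.1 hx.1.1.2 (hK1 hxK₀)
    exact ⟨E, hE, htE, hxE, hEc, huniq⟩
  have hbad₀ : ∀ y ∈ nb G Y S \ S', y ∈ K₀ := by
    intro y hy
    obtain ⟨K, hK1, ⟨D, hD, htD, hyD, hDy⟩, -⟩ := hbad y hy
    obtain ⟨b, hb⟩ := hK₀ (D ∩ K₀) Finset.inter_subset_right (Finset.mem_inter.2 ⟨htD, ht⟩)
    have := bd_inter_subset hK1 hb
    rw [hDy, Finset.mem_singleton] at this
    rw [← this]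
    exact (Finset.mem_inter.1 (bd_subset _ _ _ hb)).2
  have hpair : ∀ y ∈ nb G Y S \ S', ∀ x ∈ nb G Y S \ S', ∃ K, K₀ ⊆ K ∧ ∃ D ⊆ K, t ∈ D ∧ x ∈ D ∧
      y ∈ D ∧ bd G K A D = {y} := by
    intro y hy x hx
    obtain ⟨K, hK1, ⟨D, hD, htD, hyD, hDy⟩, h⟩ := hbad y hy
    obtain ⟨E, hE, htE, hxE, hEc, huniq⟩ := h x hx (hbad₀ x hx)
    refine ⟨K, hK1, D ∪ E, Finset.union_subset hD hE, Finset.mem_union_left _ htD,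
      Finset.mem_union_right _ hxE, Finset.mem_union_left _ hyD, ?_⟩
    exact huniq _ (Finset.union_subset hD hE) (Finset.mem_union_left _ htD)
      (Finset.mem_union_left _ hyD)
      (card_bd_union_le_one ht hK₀ hK1 htD htE (by simp [hDy]) hEc)
  have hle : (nb G Y S \ S').card ≤ 1 := by
    rw [Finset.card_le_one]
    intro y hy x hx
    obtain ⟨K, hK, D, hD, htD, hxD, hyD, hDb⟩ := hpair y hy x hx
    obtain ⟨L, hL, E, hE, htE, hyE, hxE, hEb⟩ := hpair x hx y hy
    obtain ⟨b, hb⟩ := hK₀ ((D ∪ E) ∩ K₀) Finset.inter_subset_right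
      (Finset.mem_inter.2 ⟨Finset.mem_union_left _ htD, ht⟩)
    rw [mem_bd] at hb
    obtain ⟨hb1, hb2⟩ := hb
    rw [Finset.mem_inter, Finset.mem_union] at hb1
    -- a boundary vertex of the union is a boundary vertex of each part containing it
    have hbD : b ∈ D → b = y := fun h => by
      have : b ∈ bd G K A D := mem_bd.2 ⟨h, hb2.imp id fun ⟨w, hw, hwD, hbw⟩ =>
        ⟨w, hK hw, fun h' => hwD (Finset.mem_inter.2 ⟨Finset.mem_union_left _ h', hw⟩), hbw⟩⟩
      simpa [hDb] using this
    have hbE : b ∈ E → b = x := fun h => by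
      have : b ∈ bd G L A E := mem_bd.2 ⟨h, hb2.imp id fun ⟨w, hw, hwD, hbw⟩ =>
        ⟨w, hL hw, fun h' => hwD (Finset.mem_inter.2 ⟨Finset.mem_union_right _ h', hw⟩), hbw⟩⟩
      simpa [hEb] using this
    rcases hb1.1 with h | h
    · have h1 := hbD h
      exact h1.symm.trans (hbE (h1 ▸ hyE))
    · have h1 := hbE h
      exact (hbD (h1 ▸ hxD)).symm.trans h1
  have hdisj : Disjoint S (nb G Y S) := Finset.disjoint_left.2 fun x hx hx' => (mem_nb.1 hx').1.2 hx
  have h1 : S ∪ nb G Y S ⊆ S' ∪ (nb G Y S \ S') := by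
    intro x hx
    by_cases hxS : x ∈ S'
    · exact Finset.mem_union_left _ hxS
    · rcases Finset.mem_union.1 hx with h | h
      · exact absurd (linkLayer_mono (Nat.le_succ i) h) hxS
      · exact Finset.mem_union_right _ (Finset.mem_sdiff.2 ⟨h, hxS⟩)
  have h2 := (Finset.card_le_card h1).trans (Finset.card_union_le _ _)
  rw [Finset.card_union_of_disjoint hdisj] at h2
  omega

/-- If all sets of size between `|A ∩ Y| - 1` and half of `m` have a boundary that is proportional
to their size after the loss of one vertex, then the layers grow beyond half of `m` within a
logarithmic number of steps. -/
theorem exists_half_lt_card_linkLayer {Y A K₀ : Finset V} {t : V} {δ : ℝ} {m N : ℕ} (hδ : 0 < δ)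
    (hA : A ⊆ K₀) (ht : t ∈ K₀) (htY : t ∉ Y)
    (hK₀ : ∀ D ⊆ K₀, t ∈ D → (bd G K₀ A D).Nonempty) (hAY : 2 ≤ (A ∩ Y).card)
    (h : ∀ U ⊆ Y, (A ∩ Y).card ≤ U.card + 1 → 2 * U.card ≤ m →
      δ * U.card + 1 ≤ (nb G Y U).card)
    (hN : (m : ℝ) < (1 + δ) ^ N) :
    ∃ i ≤ N, m < 2 * (linkLayer G Y A K₀ t i).card := by
  have h0 := card_sources_le_linkLayer (Y := Y) hA ht hK₀
  refine exists_half_lt_of_growth (a := fun i => (linkLayer G Y A K₀ t i).card) hδ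
    (by omega) (fun i hi => ?_) hN
  have h1 := card_linkLayer_succ ht htY hK₀ i
  have h2 := Finset.card_le_card
    (linkLayer_mono (G := G) (Y := Y) (A := A) (K₀ := K₀) (t := t) (Nat.zero_le i))
  have h3 := h _ (linkLayer_subset Y A K₀ t i) (by omega) hi
  have h4 : ((linkLayer G Y A K₀ t i).card : ℝ) + (nb G Y (linkLayer G Y A K₀ t i)).card ≤
      (linkLayer G Y A K₀ t (i + 1)).card + 1 := by exact_mod_cast h1
  linarith

end TwoLinked

/-! ### Connecting two sets, with control of the parity -/

section Connectors

variable {V : Type*} {G : SimpleGraph V}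

/-- The set `Q` connects `a` and `b`: there is a path from `a` to `b` with all inner vertices in
`Q`, and if `φ` holds, then there are such paths of both parities. -/
def Connects (G : SimpleGraph V) (φ : Prop) (a b : V) (Q : Finset V) : Prop :=
  ∀ o : Prop, ∃ p : G.Walk a b, p.IsPath ∧ (∀ x ∈ p.support, x = a ∨ x = b ∨ x ∈ Q) ∧
    (φ → (Odd p.length ↔ o))

theorem Connects.symm {φ : Prop} {a b : V} {Q : Finset V} (h : Connects G φ a b Q) :
    Connects G φ b a Q := by
  intro o
  obtain ⟨p, hp, hs, ho⟩ := h o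
  refine ⟨p.reverse, hp.reverse, fun x hx => ?_, by simpa using ho⟩
  have := hs x (by simpa using hx)
  tauto

theorem exists_connects_false {Y A₁ A₂ : Finset V} {β : ℝ} {N : ℕ} (hβ : 0 < β)
    (hY : ExpandsIn G Y β) (hN : (Y.card : ℝ) < (1 + β) ^ N)
    (h1 : (nb G Y A₁).Nonempty) (h2 : (nb G Y A₂).Nonempty) :
    ∃ t₁ ∈ A₁, ∃ t₂ ∈ A₂, ∃ Q ⊆ Y, Q.card ≤ 2 * N + 1 ∧ Connects G False t₁ t₂ Q := by
  obtain ⟨x, hx, y, hy, p, hp, hl⟩ :=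
    exists_short_walk hβ hY hN (nb_subset Y A₁) (nb_subset Y A₂) h1 h2
  obtain ⟨-, t₁, ht₁, h1⟩ := mem_nb.1 hx
  obtain ⟨-, t₂, ht₂, h2⟩ := mem_nb.1 hy
  refine ⟨t₁, ht₁, t₂, ht₂, p.support.toFinset, fun z hz => hp z (by simpa using hz),
    (card_support_toFinset_le p).trans (by omega), fun o => ?_⟩
  let q := SimpleGraph.Walk.cons h1 (p.concat h2.symm)
  refine ⟨q.bypass, q.bypass_isPath, fun z hz => ?_, False.elim⟩
  have := q.support_bypass_subset_support hz
  simp only [q, SimpleGraph.Walk.support_cons, SimpleGraph.Walk.support_concat, List.mem_cons,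
    List.mem_append, List.mem_nil_iff, or_false] at this
  simp only [List.mem_toFinset]
  tauto

/-- If an odd cycle is joined by two disjoint walks to `t₁` and `t₂`, then there are paths of both
parities from `t₁` to `t₂`. -/
theorem exists_path_through_cycle {v a₁ a₂ t₁ t₂ : V} {c : G.Walk v v} (hc : c.IsCycle)
    (hodd : Odd c.length) {F₁ F₂ : Finset V} (hF : Disjoint F₁ F₂)
    (ha₁ : a₁ ∈ c.support) (ha₂ : a₂ ∈ c.support)
    (p₁ : G.Walk a₁ t₁) (hp₁ : ∀ x ∈ p₁.support, x ∈ F₁)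
    (p₂ : G.Walk a₂ t₂) (hp₂ : ∀ x ∈ p₂.support, x ∈ F₂) (o : Prop) :
    ∃ p : G.Walk t₁ t₂, p.IsPath ∧ (∀ x ∈ p.support, x ∈ F₁ ∪ F₂ ∪ c.support.toFinset) ∧
      (Odd p.length ↔ o) := by
  obtain ⟨b₁, hb₁, q₁, hq₁, hs₁, hc₁⟩ := exists_path_from_last (C := c.support.toFinset) p₁ hp₁
    ⟨a₁, by simp, by simpa using ha₁⟩
  obtain ⟨b₂, hb₂, q₂, hq₂, hs₂, hc₂⟩ := exists_path_from_last (C := c.support.toFinset) p₂ hp₂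
    ⟨a₂, by simp, by simpa using ha₂⟩
  rw [Finset.disjoint_left] at hF
  have hne : b₁ ≠ b₂ := fun e => hF (hs₁ b₁ (by simp)) (e ▸ hs₂ b₂ (by simp))
  obtain ⟨r, hr, hrs, hro⟩ := exists_arc_of_parity hc hodd (by simpa using hb₁) (by simpa using hb₂)
    hne (Odd q₁.length ↔ (Odd q₂.length ↔ o))
  refine ⟨q₁.reverse.append (r.append q₂), ?_, ?_, ?_⟩
  · refine isPath_append hq₁.reverse (isPath_append hr hq₂ ?_) ?_
    · intro x hx hx'
      exact hc₂ x hx' (by simpa using hrs x hx)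
    · intro x hx hx'
      rw [SimpleGraph.Walk.support_reverse, List.mem_reverse] at hx
      rw [SimpleGraph.Walk.mem_support_append_iff] at hx'
      rcases hx' with hx' | hx'
      · exact hc₁ x hx (by simpa using hrs x hx')
      · exact absurd (hs₂ x hx') (hF (hs₁ x hx))
  · intro x hx
    simp only [SimpleGraph.Walk.mem_support_append_iff, SimpleGraph.Walk.support_reverse,
      List.mem_reverse] at hx
    simp only [Finset.mem_union, List.mem_toFinset]
    rcases hx with hx | hx | hx
    · exact Or.inl (Or.inl (hs₁ x hx))
    · exact Or.inr (hrs x hx)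
    · exact Or.inl (Or.inr (hs₂ x hx))
  · simp only [SimpleGraph.Walk.length_append, SimpleGraph.Walk.length_reverse, Nat.odd_add,
      ← Nat.not_odd_iff_even] at hro ⊢
    tauto

/-- If `t₁` is joined to the cycle `C`, and some `z` is linked together with `t₁` to `C` and
together with a vertex of `C` to `{t₁} ∪ N`, then `t₁` and some vertex of `N` are linked to `C`:
otherwise a set with a single boundary vertex contains `t₁` and all of `N`, and its boundary
vertex separates `z` from one of the two sides. -/
theorem exists_linked_pair {C N K K' K₀ : Finset V} {t₁ c₁ z : V} (ht₁ : t₁ ∈ K₀)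
    (hK₀ : ∀ D ⊆ K₀, t₁ ∈ D → (bd G K₀ C D).Nonempty) (hK : K₀ ⊆ K)
    (hz : TwoLinked G K C t₁ z) (hc₁ : c₁ ∈ C) (hc₁K' : c₁ ∈ K')
    (hz' : TwoLinked G K' (insert t₁ N) c₁ z) :
    ∃ t₂ ∈ N, ∀ D ⊆ K ∪ K', (({t₁, t₂} : Finset V) ∩ D).card ≤ (bd G (K ∪ K') C D).card := by
  set F := K ∪ K' with hF
  have hKF : K ⊆ F := Finset.subset_union_left
  have hK'F : K' ⊆ F := Finset.subset_union_right
  have hg : ∀ D ⊆ F, (({t₁} : Finset V) ∩ D).card ≤ 1 * (bd G F C D).card := by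
    intro D hD
    by_cases ht : t₁ ∈ D
    · rw [Finset.singleton_inter_of_mem ht]
      have := Finset.card_pos.2 (bd_nonempty_of_subset ht₁ hK₀ (hK.trans hKF) ht)
      simpa using this
    · rw [Finset.singleton_inter_of_notMem ht]; simp
  obtain ⟨T, hTF, hTt, hTmax⟩ := exists_largest_tight (G := G) (K := F) (A := C) (s := 1)
    (fun D => (({t₁} : Finset V) ∩ D).card) (by simp)
    (fun D E => by
      rw [Finset.inter_union_distrib_left, Finset.inter_inter_distrib_left]
      exact (Finset.card_union_add_card_inter _ _).ge) hg
  by_contra! hcon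
  have hNT : N ⊆ T := by
    intro t₂ ht₂
    obtain ⟨D, hD, hlt⟩ := hcon t₂ ht₂
    have h1 := hg D hD
    have h2 : t₂ ∈ D := by
      by_contra h2
      have : ({t₁, t₂} : Finset V) ∩ D = {t₁} ∩ D := by
        ext x; simp only [Finset.mem_inter, Finset.mem_insert, Finset.mem_singleton]
        constructor
        · rintro ⟨rfl | rfl, hx⟩
          · exact ⟨rfl, hx⟩
          · exact absurd hx h2
        · rintro ⟨rfl, hx⟩; exact ⟨Or.inl rfl, hx⟩
      rw [this] at hlt
      omega
    have h3 : ({t₁, t₂} : Finset V) ∩ D ⊆ insert t₂ ({t₁} ∩ D) := by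
      intro x; simp only [Finset.mem_inter, Finset.mem_insert, Finset.mem_singleton]; tauto
    have h4 := (Finset.card_le_card h3).trans (Finset.card_insert_le _ _)
    exact hTmax D hD (by omega) h2
  have hbd : (bd G F C (insert t₁ T)).card ≤ 1 := by
    by_cases ht : t₁ ∈ T
    · rw [Finset.insert_eq_of_mem ht, ← one_mul (bd G F C T).card, ← hTt]
      exact (Finset.card_le_card Finset.inter_subset_left).trans (by simp)
    · rw [Finset.singleton_inter_of_notMem ht] at hTt
      have hT0 : bd G F C T = ∅ := by
        rw [← Finset.card_eq_zero]; simpa using hTt.symm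
      have : bd G F C (insert t₁ T) ⊆ {t₁} := by
        intro x hx
        rw [mem_bd, Finset.mem_insert] at hx
        rw [Finset.mem_singleton]
        by_contra hxt
        have : x ∈ bd G F C T := mem_bd.2 ⟨hx.1.resolve_left hxt, hx.2.imp id
          fun ⟨w, hw, hwT, hxw⟩ => ⟨w, hw, fun h => hwT (Finset.mem_insert_of_mem h), hxw⟩⟩
        simp [hT0] at this
      exact (Finset.card_le_card this).trans (by simp)
  set T₁ := insert t₁ T with hT₁
  have hzT : z ∉ T₁ := by
    intro h
    have h1 := hz.2 (T₁ ∩ K) Finset.inter_subset_right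
      (Finset.mem_inter.2 ⟨Finset.mem_insert_self _ _, hK ht₁⟩) (Finset.mem_inter.2 ⟨h, hz.1⟩)
    have h2 := Finset.card_le_card (bd_inter_subset (G := G) (A := C) (D := T₁) hKF)
    omega
  -- on the other side, the complement of `T₁` together with the separator violates the linkage
  set D := K'.filter fun x => x ∉ T₁ ∨ x ∈ bd G F C T₁ with hD
  have hDsub : bd G K' (insert t₁ N) D ⊆ bd G F C T₁ := by
    intro x hx
    obtain ⟨hxD, hx2⟩ := mem_bd.1 hx
    obtain ⟨hxK', hxT⟩ := Finset.mem_filter.1 hxD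
    by_cases hxT₁ : x ∈ T₁
    · exact hxT.resolve_left (not_not.2 hxT₁)
    · exfalso
      rcases hx2 with hx2 | ⟨y, hy, hyD, hxy⟩
      · exact hxT₁ (Finset.insert_subset_insert _ hNT hx2)
      · have hyT : y ∈ T₁ ∧ y ∉ bd G F C T₁ := by
          have := fun h => hyD (Finset.mem_filter.2 ⟨hy, h⟩)
          tauto
        exact hyT.2 (mem_bd.2 ⟨hyT.1, Or.inr ⟨x, hK'F hxK', hxT₁, hxy.symm⟩⟩)
  have h1 := hz'.2 D (Finset.filter_subset _ _)
    (Finset.mem_filter.2 ⟨hc₁K', by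
      by_cases h : c₁ ∈ T₁
      · exact Or.inr (mem_bd.2 ⟨h, Or.inl hc₁⟩)
      · exact Or.inl h⟩)
    (Finset.mem_filter.2 ⟨hz'.1, Or.inl hzT⟩)
  have h2 := Finset.card_le_card hDsub
  omega

/-- In an expander containing an odd cycle that is not too short, two sets with neighbours in the
expander are connected by paths of both parities inside a set whose size is the length of the
cycle plus a logarithmic term. -/
theorem exists_connects_true {Y A₁ A₂ : Finset V} {β : ℝ} {N m : ℕ} (hβ : 0 < β)
    (hY : ExpandsIn G Y β) (hN : (Y.card : ℝ) < (1 + β / 2) ^ N)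
    {v : V} {c : G.Walk v v} (hc : c.IsCycle) (hodd : Odd c.length) (hcY : ∀ x ∈ c.support, x ∈ Y)
    (hlen : 1 + 2 / β ≤ c.length) (hA : Disjoint A₁ A₂) (hA₁ : Disjoint A₁ Y) (hA₂ : Disjoint A₂ Y)
    (h1 : (nb G Y A₁).Nonempty) (hm : 4 / β + 1 ≤ m) (h2 : m + 1 ≤ (nb G Y A₂).card) :
    ∃ t₁ ∈ A₁, ∃ t₂ ∈ A₂, ∃ Q ⊆ Y, Q.card ≤ c.length + m + 6 * N + 5 ∧
      Connects G True t₁ t₂ Q := by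
  set C := c.support.toFinset with hC
  have hCc : C.card = c.length := card_support_toFinset_of_isCycle hc
  have hCY : C ⊆ Y := fun x hx => hcY x (by simpa [hC] using hx)
  have hc3 : 3 ≤ C.card := hCc ▸ hc.three_le_length
  have hm2 : 2 ≤ m := by
    have : (0 : ℝ) < 4 / β := by positivity
    have : (1 : ℝ) < m := by linarith
    exact_mod_cast this
  have hN' : (Y.card : ℝ) < (1 + β) ^ N :=
    hN.trans_le (pow_le_pow_left₀ (by positivity) (by linarith) _)
  obtain ⟨x, hx, c₁, hc₁, p, hp, hpl⟩ := exists_short_walk hβ hY hN' (nb_subset Y A₁) hCY h1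
    (Finset.card_pos.1 (by omega))
  obtain ⟨⟨hxY, -⟩, t₁, ht₁, htx⟩ := mem_nb.1 hx
  have ht₁Y : t₁ ∉ Y := Finset.disjoint_left.1 hA₁ ht₁
  let P := SimpleGraph.Walk.cons htx p
  set S := P.support.toFinset with hS
  have hSc : S.card ≤ 2 * N + 2 := by
    have h3 : S.card ≤ P.length + 1 := card_support_toFinset_le P
    have h4 : P.length = p.length + 1 := SimpleGraph.Walk.length_cons _ _
    omega
  have hSY : S ⊆ insert t₁ Y := by
    intro y hy
    simp only [hS, P, SimpleGraph.Walk.support_cons, List.toFinset_cons, Finset.mem_insert,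
      List.mem_toFinset] at hy
    rw [Finset.mem_insert]
    exact hy.imp id (hp y)
  have ht₁S : t₁ ∈ S := by simp [hS]
  have hc₁S : c₁ ∈ S := by simp [hS]
  -- growth from the cycle
  obtain ⟨i, hi, hSi⟩ := exists_half_lt_card_linkLayer (G := G) (Y := Y) (A := C) (K₀ := C ∪ S)
    (t := t₁) (m := Y.card) (half_pos hβ) Finset.subset_union_left
    (Finset.mem_union_right _ ht₁S) ht₁Y
    (fun D _ htD => by
      obtain ⟨b, -, hb⟩ := exists_mem_bd_of_walk (K := C ∪ S) (A := C) P
        (fun y hy => Finset.mem_union_right _ (by simpa [hS] using hy)) htD (Or.inl hc₁)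
      exact ⟨b, hb⟩)
    (by rw [Finset.inter_eq_left.2 hCY]; omega)
    (fun U hU hU1 hU2 => by
      rw [Finset.inter_eq_left.2 hCY, hCc] at hU1
      have h3 := hY U hU hU2
      have h4 : (c.length : ℝ) ≤ U.card + 1 := by exact_mod_cast hU1
      have h5 : 2 / β ≤ U.card := by linarith
      rw [div_le_iff₀ hβ] at h5
      linarith) hN
  -- growth from `t₁` and the neighbours of `A₂`
  obtain ⟨N₂, hN₂, hN₂c⟩ := Finset.exists_subset_card_eq
    (show m ≤ ((nb G Y A₂).erase c₁).card by
      have := Finset.pred_card_le_card_erase (s := nb G Y A₂) (a := c₁); omega)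
  have hN₂Y : N₂ ⊆ Y.erase c₁ := hN₂.trans (Finset.erase_subset_erase _ (nb_subset _ _))
  have hint : insert t₁ N₂ ∩ Y.erase c₁ = N₂ := by
    rw [Finset.insert_inter_of_notMem (fun h => ht₁Y (Finset.mem_of_mem_erase h)),
      Finset.inter_eq_left.2 hN₂Y]
  obtain ⟨j, hj, hSj⟩ := exists_half_lt_card_linkLayer (G := G) (Y := Y.erase c₁)
    (A := insert t₁ N₂) (K₀ := insert t₁ N₂ ∪ S)
    (t := c₁) (m := Y.card) (half_pos hβ) Finset.subset_union_left
    (Finset.mem_union_right _ hc₁S) (by simp)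
    (fun D _ htD => by
      obtain ⟨b, -, hb⟩ := exists_mem_bd_of_walk (K := insert t₁ N₂ ∪ S) (A := insert t₁ N₂)
        P.reverse (fun y hy => Finset.mem_union_right _ (by simpa [hS] using hy)) htD
        (Or.inl (Finset.mem_insert_self _ _))
      exact ⟨b, hb⟩)
    (by rw [hint]; omega)
    (fun U hU hU1 hU2 => by
      rw [hint, hN₂c] at hU1
      have h3 := hY U (hU.trans (Finset.erase_subset _ _)) hU2
      have h4 : (m : ℝ) ≤ U.card + 1 := by exact_mod_cast hU1
      have h5 : 4 / β ≤ U.card := by linarith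
      rw [div_le_iff₀ hβ] at h5
      have h6 : nb G Y U ⊆ insert c₁ (nb G (Y.erase c₁) U) := by
        intro y hy
        rw [Finset.mem_insert]
        by_cases hyc : y = c₁
        · exact Or.inl hyc
        · have := mem_nb.1 hy
          exact Or.inr (mem_nb.2 ⟨⟨Finset.mem_erase.2 ⟨hyc, this.1.1⟩, this.1.2⟩, this.2⟩)
      have h7 := (Finset.card_le_card h6).trans (Finset.card_insert_le _ _)
      have h8 : ((nb G Y U).card : ℝ) ≤ (nb G (Y.erase c₁) U).card + 1 := by exact_mod_cast h7
      linarith) hN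
  obtain ⟨z, hz, hz'⟩ := exists_mem_inter_of_half_lt (linkLayer_subset _ _ _ _ _)
    ((linkLayer_subset _ _ _ _ _).trans (Finset.erase_subset _ _)) hSi hSj
  obtain ⟨-, K, hK1, hK2, hK3, hzK⟩ := mem_linkLayer.1 hz
  obtain ⟨-, K', hK1', hK2', hK3', hzK'⟩ := mem_linkLayer.1 hz'
  obtain ⟨y, hy, hlink⟩ := exists_linked_pair (K₀ := C ∪ S) (N := N₂)
    (Finset.mem_union_right _ ht₁S)
    (fun D _ htD => by
      obtain ⟨b, -, hb⟩ := exists_mem_bd_of_walk (K := C ∪ S) (A := C) P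
        (fun y hy => Finset.mem_union_right _ (by simpa [hS] using hy)) htD (Or.inl hc₁)
      exact ⟨b, hb⟩) hK1 hzK hc₁ (hK1' (Finset.mem_union_right _ hc₁S))
    hzK'
  set F := K ∪ K' with hF
  have hyY : y ∈ Y := Finset.mem_of_mem_erase (hN₂Y hy)
  have ht₁y : t₁ ≠ y := fun e => ht₁Y (e ▸ hyY)
  have hCF : C ⊆ F := (Finset.subset_union_left.trans hK1).trans Finset.subset_union_left
  have hFY : F ⊆ insert t₁ Y := by
    refine Finset.union_subset (hK2.trans ?_) (hK2'.trans ?_)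
    · exact Finset.union_subset (Finset.union_subset (hCY.trans (Finset.subset_insert _ _)) hSY)
        (Finset.subset_insert _ _)
    · exact Finset.union_subset (Finset.union_subset (Finset.insert_subset_insert _
        (hN₂Y.trans (Finset.erase_subset _ _))) hSY)
        ((Finset.erase_subset _ _).trans (Finset.subset_insert _ _))
  obtain ⟨R, hR1, hR2, hR3⟩ := exists_disjoint_regions (G := G) (K := F) (A := C) (T := {t₁, y})
    (by
      intro w hw
      rw [Finset.mem_insert, Finset.mem_singleton] at hw
      rcases hw with rfl | rfl
      · exact Finset.mem_union_left _ (hK1 (Finset.mem_union_right _ ht₁S))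
      · exact Finset.mem_union_right _ (hK1' (Finset.mem_union_left _
          (Finset.mem_insert_of_mem hy)))) hlink
  obtain ⟨a₁, ha₁, p₁, hp₁⟩ := hR2 t₁ (by simp)
  obtain ⟨a₂, ha₂, p₂, hp₂⟩ := hR2 y (by simp)
  have hR : Disjoint (R t₁) (R y) := hR3 t₁ (by simp) y (by simp) ht₁y
  obtain ⟨-, t₂, ht₂, hty⟩ := mem_nb.1 (Finset.mem_of_mem_erase (hN₂ hy))
  have ht₂Y : t₂ ∉ Y := Finset.disjoint_left.1 hA₂ ht₂
  have ht₁₂ : t₁ ≠ t₂ := fun e => Finset.disjoint_left.1 hA ht₁ (e ▸ ht₂)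
  have ht₂F : t₂ ∉ F := fun h => by
    have := hFY h
    rw [Finset.mem_insert] at this
    exact this.elim (fun e => ht₁₂ e.symm) ht₂Y
  refine ⟨t₁, ht₁, t₂, ht₂, F.erase t₁, ?_, ?_, ?_⟩
  · intro w hw
    rw [Finset.mem_erase] at hw
    exact (Finset.mem_insert.1 (hFY hw.2)).resolve_left hw.1
  · have e1 : F.card ≤ K.card + K'.card := Finset.card_union_le K K'
    have e2 := Finset.card_union_le C S
    have e3 := Finset.card_union_le (insert t₁ N₂) S
    have e4 := Finset.card_insert_le t₁ N₂
    have e5 := Finset.card_le_card (Finset.erase_subset t₁ F)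
    omega
  · intro o
    obtain ⟨q, hq, hqs, hqo⟩ := exists_path_through_cycle hc hodd hR
      (by simpa [hC] using ha₁) (by simpa [hC] using ha₂) p₁ hp₁ p₂ hp₂ (¬ o)
    have hqF : ∀ w ∈ q.support, w ∈ F := by
      intro w hw
      have := hqs w hw
      rw [Finset.mem_union, Finset.mem_union] at this
      rcases this with (h | h) | h
      · exact hR1 t₁ (by simp) h
      · exact hR1 y (by simp) h
      · exact hCF h
    refine ⟨q.concat hty.symm, hq.concat (fun h => ht₂F (hqF _ h)) _, ?_, ?_⟩
    · intro w hw
      simp only [SimpleGraph.Walk.support_concat, List.mem_append, List.mem_singleton] at hw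
      rcases hw with hw | rfl
      · by_cases hwt : w = t₁
        · exact Or.inl hwt
        · exact Or.inr (Or.inr (Finset.mem_erase.2 ⟨hwt, hqF w hw⟩))
      · exact Or.inr (Or.inl rfl)
    · intro _
      rw [SimpleGraph.Walk.length_concat, Nat.odd_add_one]
      tauto

end Connectors

/-! ### Partial embeddings and the embedding process -/

section PartialEmbedding

variable {V W : Type*} [Fintype V] {G : SimpleGraph V}

/-- A partial embedding into `G` of the graph on `W` with edge set `E₀`.  A set `B` of vertices has
been discarded; the vertices in `S` have been placed and the edges in `E` have been embedded.
A placed vertex `w` owns a `center w` and a set `K w` of `q w * s` vertices, whose subset `L w`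
consists of neighbours of the centre.  An embedded edge `e` owns a connecting set `Q e` of at most
`s` vertices, attached to `K w` at the vertex `t w e` for each end `w` of `e`. -/
structure PartialEmbedding (G : SimpleGraph V) (E₀ : Finset (Sym2 W)) (s : ℕ) (q : W → ℕ)
    (φ : Prop) (η : ℝ) where
  B : Finset V
  S : Finset W
  E : Finset (Sym2 W)
  center : W → V
  L : W → Finset V
  K : W → Finset V
  t : W → Sym2 W → V
  Q : Sym2 W → Finset V
  E_sub : E ⊆ E₀
  mem_S : ∀ e ∈ E, ∀ w ∈ e, w ∈ S
  center_notMem : ∀ w ∈ S, center w ∉ K w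
  L_sub : ∀ w ∈ S, L w ⊆ K w
  L_adj : ∀ w ∈ S, ∀ x ∈ L w, G.Adj (center w) x
  card_K : ∀ w ∈ S, (K w).card = q w * s
  /-- Few vertices separate only small sets from the centre. -/
  expand : ∀ w ∈ S, ∀ D ⊆ K w, D.card ≤ s * (bd G (K w) (L w) D).card
  t_mem : ∀ e ∈ E, ∀ w ∈ e, t w e ∈ K w
  /-- The hypothesis of Menger's theorem for the attachment vertices in `K w`. -/
  linked : ∀ w ∈ S, ∀ D ⊆ K w,
    (E.filter fun e => w ∈ e ∧ t w e ∈ D).card ≤ (bd G (K w) (L w) D).card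
  conn : ∀ u v, s(u, v) ∈ E → Connects G φ (t u s(u, v)) (t v s(u, v)) (Q s(u, v))
  card_Q : ∀ e ∈ E, (Q e).card ≤ s
  disj_star : ∀ w ∈ S, ∀ w' ∈ S, w ≠ w' →
    Disjoint (insert (center w) (K w)) (insert (center w') (K w'))
  disj_Q : ∀ e ∈ E, ∀ e' ∈ E, e ≠ e' → Disjoint (Q e) (Q e')
  disj_star_Q : ∀ w ∈ S, ∀ e ∈ E, Disjoint (insert (center w) (K w)) (Q e)
  disj_star_B : ∀ w ∈ S, Disjoint (insert (center w) (K w)) B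
  disj_Q_B : ∀ e ∈ E, Disjoint (Q e) B
  two_mul_card_B : 2 * B.card ≤ Fintype.card V
  /-- The discarded set has few neighbours among the vertices that are neither used nor
  discarded. -/
  card_nb_B : ((nb G (Finset.univ \ (B ∪ (S.biUnion (fun w => insert (center w) (K w)) ∪
    E.biUnion Q))) B).card : ℝ) ≤ η * B.card

namespace PartialEmbedding

variable {E₀ : Finset (Sym2 W)} {s : ℕ} {q : W → ℕ} {φ : Prop} {η : ℝ}
  (c : PartialEmbedding G E₀ s q φ η)

/-- The vertices used by the embedding. -/
noncomputable def used : Finset V :=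
  c.S.biUnion (fun w => insert (c.center w) (c.K w)) ∪ c.E.biUnion c.Q

/-- The vertices that are neither used nor discarded. -/
noncomputable def rest : Finset V := Finset.univ \ (c.B ∪ c.used)

theorem mem_used {x : V} :
    x ∈ c.used ↔ (∃ w ∈ c.S, x ∈ insert (c.center w) (c.K w)) ∨ ∃ e ∈ c.E, x ∈ c.Q e := by
  rw [used, Finset.mem_union, Finset.mem_biUnion, Finset.mem_biUnion]

theorem mem_rest {x : V} : x ∈ c.rest ↔ x ∉ c.B ∧ x ∉ c.used := by
  simp [rest]

theorem disj_star_rest {w : W} (hw : w ∈ c.S) :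
    Disjoint (insert (c.center w) (c.K w)) c.rest :=
  Finset.disjoint_left.2 fun _ hx hx' => (c.mem_rest.1 hx').2 (c.mem_used.2 (Or.inl ⟨w, hw, hx⟩))

theorem disj_Q_rest {e : Sym2 W} (he : e ∈ c.E) : Disjoint (c.Q e) c.rest :=
  Finset.disjoint_left.2 fun _ hx hx' => (c.mem_rest.1 hx').2 (c.mem_used.2 (Or.inr ⟨e, he, hx⟩))

theorem card_nb_rest_B : ((nb G c.rest c.B).card : ℝ) ≤ η * c.B.card := c.card_nb_B

theorem card_used_le [Fintype W] : c.used.card ≤ ∑ w, (q w * s + 1) + E₀.card * s := by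
  refine (Finset.card_union_le _ _).trans (add_le_add ?_ ?_)
  · refine Finset.card_biUnion_le.trans ?_
    refine (Finset.sum_le_sum (g := fun w => q w * s + 1) fun w hw => ?_).trans
      (Finset.sum_le_univ_sum_of_nonneg fun _ => Nat.zero_le _)
    rw [← c.card_K w hw]
    exact Finset.card_insert_le _ _
  · refine (Finset.card_biUnion_le_card_mul _ _ s c.card_Q).trans ?_
    exact Nat.mul_le_mul_right _ (Finset.card_le_card c.E_sub)

/-- The embedding of nothing. -/
noncomputable def empty [Nonempty V] : PartialEmbedding G E₀ s q φ η where
  B := ∅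
  S := ∅
  E := ∅
  center := fun _ => Classical.arbitrary V
  L := fun _ => ∅
  K := fun _ => ∅
  t := fun _ _ => Classical.arbitrary V
  Q := fun _ => ∅
  E_sub := by simp
  mem_S := by simp
  center_notMem := by simp
  L_sub := by simp
  L_adj := by simp
  card_K := by simp
  expand := by simp
  t_mem := by simp
  linked := by simp
  conn := by simp
  card_Q := by simp
  disj_star := by simp
  disj_Q := by simp
  disj_star_Q := by simp
  disj_star_B := by simp
  disj_Q_B := by simp
  two_mul_card_B := by simp
  card_nb_B := by simp [nb]

theorem exists_discard {U : Finset V} (hU : U ⊆ c.rest)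
    (hUη : ((nb G c.rest U).card : ℝ) ≤ η * U.card)
    (h2 : 2 * (c.B.card + U.card) ≤ Fintype.card V) :
    ∃ c' : PartialEmbedding G E₀ s q φ η, c'.B.card = c.B.card + U.card := by
  have hdB : Disjoint c.B U :=
    Finset.disjoint_left.2 fun x hx hx' => (c.mem_rest.1 (hU hx')).1 hx
  have hc : (c.B ∪ U).card = c.B.card + U.card := Finset.card_union_of_disjoint hdB
  refine ⟨{ c with
    B := c.B ∪ U
    disj_star_B := fun w hw => ?_
    disj_Q_B := fun e he => ?_
    two_mul_card_B := ?_
    card_nb_B := ?_ }, hc⟩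
  · exact Finset.disjoint_union_right.2 ⟨c.disj_star_B w hw, (c.disj_star_rest hw).mono_right hU⟩
  · exact Finset.disjoint_union_right.2 ⟨c.disj_Q_B e he, (c.disj_Q_rest he).mono_right hU⟩
  · rw [hc]; exact h2
  · change ((nb G (Finset.univ \ (c.B ∪ U ∪ c.used)) (c.B ∪ U)).card : ℝ) ≤ _
    have hsub : nb G (Finset.univ \ (c.B ∪ U ∪ c.used)) (c.B ∪ U) ⊆
        nb G c.rest c.B ∪ nb G c.rest U := by
      intro x hx
      simp only [mem_nb, Finset.mem_union, Finset.mem_sdiff, Finset.mem_univ, true_and,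
        mem_rest] at hx ⊢
      grind
    have h3 := (Finset.card_le_card hsub).trans (Finset.card_union_le _ _)
    have h4 : ((nb G (Finset.univ \ (c.B ∪ U ∪ c.used)) (c.B ∪ U)).card : ℝ) ≤
        (nb G c.rest c.B).card + (nb G c.rest U).card := by exact_mod_cast h3
    have h5 := c.card_nb_rest_B
    rw [hc]
    push_cast
    linarith

theorem exists_place {w : W} (hw : w ∉ c.S) {v : V} {L K : Finset V} (hv : v ∈ c.rest)
    (hK : K ⊆ c.rest.erase v) (hLK : L ⊆ K) (hL : ∀ x ∈ L, G.Adj v x) (hKc : K.card = q w * s)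
    (hexp : ∀ D ⊆ K, D.card ≤ s * (bd G K L D).card) :
    ∃ c' : PartialEmbedding G E₀ s q φ η, c'.B = c.B ∧ c'.S.card = c.S.card + 1 := by
  have hvK : v ∉ K := fun h => by simpa using hK h
  have hE : ∀ e ∈ c.E, w ∉ e := fun e he h => hw (c.mem_S e he w h)
  have hstar : insert v K ⊆ c.rest :=
    Finset.insert_subset hv (hK.trans (Finset.erase_subset _ _))
  have hne : ∀ x ∈ c.S, x ≠ w := fun x hx e => hw (e ▸ hx)
  have hst : ∀ x ∈ c.S, insert (if x = w then v else c.center x) (if x = w then K else c.K x) =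
      insert (c.center x) (c.K x) := fun x hx => by simp [hne x hx]
  have hlink : (c.E.filter fun e => w ∈ e).card = 0 := by
    rw [Finset.card_eq_zero, Finset.filter_eq_empty_iff]
    exact hE
  refine ⟨{ c with
    S := insert w c.S
    center := fun x => if x = w then v else c.center x
    L := fun x => if x = w then L else c.L x
    K := fun x => if x = w then K else c.K x
    mem_S := fun e he x hx => Finset.mem_insert_of_mem (c.mem_S e he x hx)
    center_notMem := ?_
    L_sub := ?_
    L_adj := ?_
    card_K := ?_
    expand := ?_
    t_mem := ?_
    linked := ?_
    disj_star := ?_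
    disj_star_Q := ?_
    disj_star_B := ?_
    card_nb_B := ?_ }, rfl, Finset.card_insert_of_notMem hw⟩
  · intro x hx
    rcases Finset.mem_insert.1 hx with rfl | hx
    · simpa using hvK
    · simpa [hne x hx] using c.center_notMem x hx
  · intro x hx
    rcases Finset.mem_insert.1 hx with rfl | hx
    · simpa using hLK
    · simpa [hne x hx] using c.L_sub x hx
  · intro x hx
    rcases Finset.mem_insert.1 hx with rfl | hx
    · simpa using hL
    · simpa [hne x hx] using c.L_adj x hx
  · intro x hx
    rcases Finset.mem_insert.1 hx with rfl | hx
    · simpa using hKc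
    · simpa [hne x hx] using c.card_K x hx
  · intro x hx
    rcases Finset.mem_insert.1 hx with rfl | hx
    · simpa using hexp
    · simpa [hne x hx] using c.expand x hx
  · intro e he x hx
    have : x ≠ w := fun h => hE e he (h ▸ hx)
    simpa [this] using c.t_mem e he x hx
  · intro x hx
    rcases Finset.mem_insert.1 hx with rfl | hx
    · intro D _
      refine le_trans ?_ (Nat.zero_le _)
      rw [← hlink]
      exact Finset.card_le_card (Finset.monotone_filter_right _ fun e _ h => h.1)
    · simpa [hne x hx] using c.linked x hx
  · intro x hx y hy hxy
    rcases Finset.mem_insert.1 hx with hxw | hx' <;> rcases Finset.mem_insert.1 hy with hyw | hy'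
    · exact absurd (hxw.trans hyw.symm) hxy
    · rw [hst y hy', if_pos hxw, if_pos hxw]
      exact ((c.disj_star_rest hy').mono_right hstar).symm
    · rw [hst x hx', if_pos hyw, if_pos hyw]
      exact (c.disj_star_rest hx').mono_right hstar
    · rw [hst x hx', hst y hy']
      exact c.disj_star x hx' y hy' hxy
  · intro x hx e he
    rcases Finset.mem_insert.1 hx with rfl | hx
    · rw [if_pos rfl, if_pos rfl]
      exact ((c.disj_Q_rest he).mono_right hstar).symm
    · rw [hst x hx]
      exact c.disj_star_Q x hx e he
  · intro x hx
    rcases Finset.mem_insert.1 hx with rfl | hx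
    · rw [if_pos rfl, if_pos rfl]
      exact Finset.disjoint_left.2 fun y hy => (c.mem_rest.1 (hstar hy)).1
    · rw [hst x hx]
      exact c.disj_star_B x hx
  · refine le_trans ?_ c.card_nb_rest_B
    refine Nat.cast_le.2 (Finset.card_le_card (nb_mono ?_))
    intro y hy
    simp only [Finset.mem_sdiff, Finset.mem_univ, true_and, Finset.mem_union, Finset.mem_biUnion,
      not_or, not_exists, not_and] at hy
    refine c.mem_rest.2 ⟨hy.1, fun h => ?_⟩
    rcases c.mem_used.1 h with ⟨x, hx, hyx⟩ | ⟨e, he, hye⟩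
    · exact hy.2.1 x (Finset.mem_insert_of_mem hx) (by rw [hst x hx]; exact hyx)
    · exact hy.2.2 e he hye

/-- A placed vertex `u` is given up, together with the embedded edges at `u`, and a part `A` of
its set `K u` with few neighbours is discarded. -/
theorem exists_unplace {u : W} (hu : u ∈ c.S) {A : Finset V} (hA : A ⊆ c.K u)
    (hAη : ((nb G c.rest A).card : ℝ) + (c.K u \ A).card + 1 +
      (c.E.filter fun e => u ∈ e).card * s ≤ η * A.card)
    (h2 : 2 * (c.B.card + A.card) ≤ Fintype.card V) :
    ∃ c' : PartialEmbedding G E₀ s q φ η, c'.B.card = c.B.card + A.card := by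
  have hAst : A ⊆ insert (c.center u) (c.K u) := hA.trans (Finset.subset_insert _ _)
  have hdB : Disjoint c.B A := ((c.disj_star_B u hu).mono_left hAst).symm
  have hc : (c.B ∪ A).card = c.B.card + A.card := Finset.card_union_of_disjoint hdB
  set E' := c.E.filter fun e => u ∉ e with hE'
  have hEE : E' ⊆ c.E := Finset.filter_subset _ _
  refine ⟨{ c with
    B := c.B ∪ A
    S := c.S.erase u
    E := E'
    E_sub := hEE.trans c.E_sub
    mem_S := ?_
    center_notMem := fun w hw => c.center_notMem w (Finset.mem_of_mem_erase hw)
    L_sub := fun w hw => c.L_sub w (Finset.mem_of_mem_erase hw)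
    L_adj := fun w hw => c.L_adj w (Finset.mem_of_mem_erase hw)
    card_K := fun w hw => c.card_K w (Finset.mem_of_mem_erase hw)
    expand := fun w hw => c.expand w (Finset.mem_of_mem_erase hw)
    t_mem := fun e he => c.t_mem e (hEE he)
    linked := ?_
    conn := fun x y h => c.conn x y (hEE h)
    card_Q := fun e he => c.card_Q e (hEE he)
    disj_star := fun w hw w' hw' => c.disj_star w (Finset.mem_of_mem_erase hw) w'
      (Finset.mem_of_mem_erase hw')
    disj_Q := fun e he e' he' => c.disj_Q e (hEE he) e' (hEE he')
    disj_star_Q := fun w hw e he => c.disj_star_Q w (Finset.mem_of_mem_erase hw) e (hEE he)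
    disj_star_B := ?_
    disj_Q_B := ?_
    two_mul_card_B := ?_
    card_nb_B := ?_ }, hc⟩
  · intro e he w hw
    rw [hE', Finset.mem_filter] at he
    exact Finset.mem_erase.2 ⟨fun h => he.2 (h ▸ hw), c.mem_S e he.1 w hw⟩
  · intro w hw D hD
    refine (Finset.card_le_card ?_).trans (c.linked w (Finset.mem_of_mem_erase hw) D hD)
    exact Finset.filter_subset_filter _ hEE
  · intro w hw
    rw [Finset.mem_erase] at hw
    exact Finset.disjoint_union_right.2 ⟨c.disj_star_B w hw.2,
      (c.disj_star w hw.2 u hu hw.1).mono_right hAst⟩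
  · intro e he
    exact Finset.disjoint_union_right.2 ⟨c.disj_Q_B e (hEE he),
      ((c.disj_star_Q u hu e (hEE he)).mono_left hAst).symm⟩
  · rw [hc]; exact h2
  · set F := insert (c.center u) (c.K u \ A) ∪ (c.E.filter fun e => u ∈ e).biUnion c.Q with hF
    set Y' := Finset.univ \ (c.B ∪ A ∪ ((c.S.erase u).biUnion
      (fun w => insert (c.center w) (c.K w)) ∪ E'.biUnion c.Q)) with hY'
    -- a vertex that becomes free belongs to the star of `u` or to an edge at `u`
    have hY'F : ∀ y ∈ Y', y ∉ F → y ∈ c.rest := by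
      intro y hy hyF
      simp only [hY', Finset.mem_sdiff, Finset.mem_univ, true_and, Finset.mem_union,
        Finset.mem_biUnion, not_or, not_exists, not_and] at hy
      simp only [hF, Finset.mem_union, Finset.mem_biUnion, not_or, not_exists, not_and,
        Finset.mem_insert, Finset.mem_sdiff, not_not] at hyF
      refine c.mem_rest.2 ⟨hy.1.1, fun h => ?_⟩
      rcases c.mem_used.1 h with ⟨w, hw, hyw⟩ | ⟨e, he, hye⟩
      · by_cases hwu : w = u
        · subst hwu
          rcases Finset.mem_insert.1 hyw with h | h
          · exact hyF.1.1 h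
          · exact hy.1.2 (hyF.1.2 h)
        · exact hy.2.1 w (Finset.mem_erase.2 ⟨hwu, hw⟩) hyw
      · by_cases hue : u ∈ e
        · exact hyF.2 e (Finset.mem_filter.2 ⟨he, hue⟩) hye
        · exact hy.2.2 e (Finset.mem_filter.2 ⟨he, hue⟩) hye
    have hsub : nb G Y' (c.B ∪ A) ⊆ (nb G c.rest c.B ∪ nb G c.rest A) ∪ F := by
      intro x hx
      obtain ⟨⟨hxY, hxB⟩, y, hy, hyx⟩ := mem_nb.1 hx
      by_cases hxF : x ∈ F
      · exact Finset.mem_union_right _ hxF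
      · have hxr := hY'F x hxY hxF
        rw [Finset.mem_union, not_or] at hxB
        refine Finset.mem_union_left _ (Finset.mem_union.2 ?_)
        exact (Finset.mem_union.1 hy).imp (fun h => mem_nb.2 ⟨⟨hxr, hxB.1⟩, y, h, hyx⟩)
          (fun h => mem_nb.2 ⟨⟨hxr, hxB.2⟩, y, h, hyx⟩)
    have h3 := (Finset.card_le_card hsub).trans ((Finset.card_union_le _ _).trans
      (add_le_add_left (Finset.card_union_le _ _) _))
    have h4 : F.card ≤ (c.K u \ A).card + 1 + (c.E.filter fun e => u ∈ e).card * s := by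
      refine (Finset.card_union_le _ _).trans (add_le_add (Finset.card_insert_le _ _) ?_)
      exact Finset.card_biUnion_le_card_mul _ _ s fun e he =>
        c.card_Q e (Finset.mem_filter.1 he).1
    have h5 : ((nb G Y' (c.B ∪ A)).card : ℝ) ≤ (nb G c.rest c.B).card + (nb G c.rest A).card +
        ((c.K u \ A).card + 1 + (c.E.filter fun e => u ∈ e).card * s) := by
      exact_mod_cast h3.trans (by omega)
    have h6 := c.card_nb_rest_B
    rw [hc]
    push_cast
    linarith

/-- The vertices of `K u` at which a further edge can be attached. -/
theorem exists_attachable {u : W} (hu : u ∈ c.S) :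
    ∃ T ⊆ c.K u, T.card ≤ s * (c.E.filter fun e => u ∈ e).card ∧ ∀ x ∈ c.K u, x ∉ T →
      ∀ D ⊆ c.K u, x ∈ D → (c.E.filter fun e => u ∈ e ∧ c.t u e ∈ D).card + 1 ≤
        (bd G (c.K u) (c.L u) D).card := by
  obtain ⟨T, hTK, hTt, hTmax⟩ := exists_largest_tight (G := G) (K := c.K u) (A := c.L u) (s := 1)
    (fun D => (c.E.filter fun e => u ∈ e ∧ c.t u e ∈ D).card) (by simp)
    (fun D E => by
      rw [← Finset.card_union_add_card_inter]
      apply le_of_eq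
      congr 2
      · ext e; simp only [Finset.mem_union, Finset.mem_filter]; tauto
      · ext e; simp only [Finset.mem_inter, Finset.mem_filter]; tauto)
    (fun D hD => by rw [one_mul]; exact c.linked u hu D hD)
  refine ⟨T, hTK, ?_, ?_⟩
  · refine (c.expand u hu T hTK).trans (Nat.mul_le_mul_left s ?_)
    rw [← one_mul (bd G _ _ _).card, ← hTt]
    exact Finset.card_le_card (Finset.monotone_filter_right _ fun e _ h => h.1)
  · intro x _ hxT D hD hxD
    have h1 := c.linked u hu D hD
    have h2 : (c.E.filter fun e => u ∈ e ∧ c.t u e ∈ D).card ≠ 1 * (bd G (c.K u) (c.L u) D).card :=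
      fun h => hxT (hTmax D hD h hxD)
    omega

theorem exists_connect {u v : W} (huv : u ≠ v) (he₀ : s(u, v) ∈ E₀) (he : s(u, v) ∉ c.E)
    (hu : u ∈ c.S) (hv : v ∈ c.S) {t₁ t₂ : V} {Q : Finset V} (ht₁ : t₁ ∈ c.K u)
    (ht₂ : t₂ ∈ c.K v)
    (h₁ : ∀ D ⊆ c.K u, t₁ ∈ D → (c.E.filter fun e => u ∈ e ∧ c.t u e ∈ D).card + 1 ≤
      (bd G (c.K u) (c.L u) D).card)
    (h₂ : ∀ D ⊆ c.K v, t₂ ∈ D → (c.E.filter fun e => v ∈ e ∧ c.t v e ∈ D).card + 1 ≤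
      (bd G (c.K v) (c.L v) D).card)
    (hQ : Q ⊆ c.rest) (hQs : Q.card ≤ s) (hconn : Connects G φ t₁ t₂ Q) :
    ∃ c' : PartialEmbedding G E₀ s q φ η, c'.B = c.B ∧ c'.S = c.S ∧ c'.E.card = c.E.card + 1 := by
  set e₁ := s(u, v) with he₁
  have hne : ∀ e ∈ c.E, e ≠ e₁ := fun e h h' => he (h' ▸ h)
  let t₀ : W → V := fun w => if w = u then t₁ else t₂
  have ht₀u : t₀ u = t₁ := if_pos rfl
  have ht₀v : t₀ v = t₂ := if_neg huv.symm
  have hmem : ∀ w, w ∈ e₁ → w = u ∨ w = v := fun w hw => by simpa [he₁] using hw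
  have ht₀K : ∀ w ∈ e₁, t₀ w ∈ c.K w := by
    intro w hw
    rcases hmem w hw with rfl | rfl
    · rwa [ht₀u]
    · rwa [ht₀v]
  have ht₀l : ∀ w ∈ e₁, ∀ D ⊆ c.K w, t₀ w ∈ D →
      (c.E.filter fun e => w ∈ e ∧ c.t w e ∈ D).card + 1 ≤ (bd G (c.K w) (c.L w) D).card := by
    intro w hw
    rcases hmem w hw with rfl | rfl
    · rwa [ht₀u]
    · rwa [ht₀v]
  refine ⟨{ c with
    E := insert e₁ c.E
    t := fun w e => if e = e₁ then t₀ w else c.t w e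
    Q := fun e => if e = e₁ then Q else c.Q e
    E_sub := Finset.insert_subset he₀ c.E_sub
    mem_S := ?_
    t_mem := ?_
    linked := ?_
    conn := ?_
    card_Q := ?_
    disj_Q := ?_
    disj_star_Q := ?_
    disj_Q_B := ?_
    card_nb_B := ?_ }, rfl, rfl, Finset.card_insert_of_notMem he⟩
  · intro e h w hw
    rcases Finset.mem_insert.1 h with rfl | h
    · rcases hmem w hw with rfl | rfl
      · exact hu
      · exact hv
    · exact c.mem_S e h w hw
  · intro e h w hw
    rcases Finset.mem_insert.1 h with rfl | h
    · simpa using ht₀K w hw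
    · simpa [hne e h] using c.t_mem e h w hw
  · intro w hw D hD
    have hold : (c.E.filter fun e => w ∈ e ∧ (if e = e₁ then t₀ w else c.t w e) ∈ D) =
        c.E.filter fun e => w ∈ e ∧ c.t w e ∈ D :=
      Finset.filter_congr fun e h => by simp [hne e h]
    rw [Finset.filter_insert, hold]
    simp only [↓reduceIte]
    split_ifs with h
    · exact (Finset.card_insert_le _ _).trans (ht₀l w h.1 D hD h.2)
    · exact c.linked w hw D hD
  · intro x y h
    by_cases hxy : s(x, y) = e₁
    · simp only [hxy, if_true]
      rw [he₁, Sym2.eq_iff] at hxy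
      rcases hxy with ⟨rfl, rfl⟩ | ⟨rfl, rfl⟩
      · rwa [ht₀u, ht₀v]
      · rw [ht₀u, ht₀v]; exact hconn.symm
    · simp only [hxy, if_false]
      exact c.conn x y ((Finset.mem_insert.1 h).resolve_left hxy)
  · intro e h
    rcases Finset.mem_insert.1 h with rfl | h
    · simpa using hQs
    · simpa [hne e h] using c.card_Q e h
  · intro e h e' h' hee
    rcases Finset.mem_insert.1 h with rfl | h <;> rcases Finset.mem_insert.1 h' with rfl | h'
    · exact absurd rfl hee
    · rw [if_pos rfl, if_neg (hne e' h')]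
      exact ((c.disj_Q_rest h').mono_right hQ).symm
    · rw [if_pos rfl, if_neg (hne e h)]
      exact (c.disj_Q_rest h).mono_right hQ
    · rw [if_neg (hne e h), if_neg (hne e' h')]
      exact c.disj_Q e h e' h' hee
  · intro w hw e h
    rcases Finset.mem_insert.1 h with rfl | h
    · rw [if_pos rfl]
      exact (c.disj_star_rest hw).mono_right hQ
    · rw [if_neg (hne e h)]
      exact c.disj_star_Q w hw e h
  · intro e h
    rcases Finset.mem_insert.1 h with rfl | h
    · rw [if_pos rfl]
      exact Finset.disjoint_left.2 fun y hy => (c.mem_rest.1 (hQ hy)).1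
    · rw [if_neg (hne e h)]
      exact c.disj_Q_B e h
  · refine le_trans ?_ c.card_nb_rest_B
    refine Nat.cast_le.2 (Finset.card_le_card (nb_mono ?_))
    intro y hy
    simp only [Finset.mem_sdiff, Finset.mem_univ, true_and, Finset.mem_union, Finset.mem_biUnion,
      not_or, not_exists, not_and] at hy
    refine c.mem_rest.2 ⟨hy.1, fun h => ?_⟩
    rcases c.mem_used.1 h with ⟨x, hx, hyx⟩ | ⟨e, h, hye⟩
    · exact hy.2.1 x hx hyx
    · exact hy.2.2 e (Finset.mem_insert_of_mem h) (by rwa [if_neg (hne e h)])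

/-- **The embedding process.**  A partial embedding that is extremal, first for the number of
discarded vertices, then for the number of placed vertices, then for the number of embedded edges,
is complete.  By the expansion of `G`, the boundary condition bounds the discarded set by `b`, and a
set that violates the expansion of the remaining graph by `u₀`. -/
theorem exists_complete [Fintype W] [Nonempty V] {α β x b u₀ : ℝ} (hα : IsExpander G α)
    (hβ : 0 < β) (hβη : β ≤ η) (hηα : η < α) (hs : 1 ≤ s) (hE₀ : ∀ e ∈ E₀, ¬ e.IsDiag)
    (hx : ((∑ w, (q w * s + 1) + E₀.card * s : ℕ) : ℝ) ≤ x)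
    (hb : x ≤ (α - η) * b) (hu₀ : b + x ≤ (α - β) * u₀)
    (hn₁ : 2 * (b + x) ≤ Fintype.card V) (hn₂ : 2 * (b + u₀) ≤ Fintype.card V)
    (hq₁ : ∀ w, 3 * ((E₀.filter fun e => w ∈ e).card : ℝ) ≤
      (η - β) * (q w - (E₀.filter fun e => w ∈ e).card))
    (hq₂ : ∀ w, 1 ≤ (E₀.filter fun e => w ∈ e).card →
      1 ≤ β * (q w - (E₀.filter fun e => w ∈ e).card))
    (hstar : ∀ Y : Finset V, (Fintype.card V : ℝ) - (b + x) ≤ Y.card → ExpandsIn G Y β → ∀ w : W,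
      ∃ v ∈ Y, ∃ L K : Finset V, K ⊆ Y.erase v ∧ L ⊆ K ∧ (∀ x ∈ L, G.Adj v x) ∧
        K.card = q w * s ∧ ∀ D ⊆ K, D.card ≤ s * (bd G K L D).card)
    (hconn : ∀ Y : Finset V, (Fintype.card V : ℝ) - (b + x) ≤ Y.card → ExpandsIn G Y β →
      ∀ A₁ A₂ : Finset V, Disjoint A₁ A₂ → Disjoint A₁ Y → Disjoint A₂ Y →
        s ≤ (nb G Y A₁).card → s ≤ (nb G Y A₂).card →
        ∃ t₁ ∈ A₁, ∃ t₂ ∈ A₂, ∃ Q ⊆ Y, Q.card ≤ s ∧ Connects G φ t₁ t₂ Q) :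
    ∃ c : PartialEmbedding G E₀ s q φ η, c.S = Finset.univ ∧ c.E = E₀ := by
  -- the components decrease along progress, so an extremal partial embedding is a minimum
  let μ : PartialEmbedding G E₀ s q φ η → ℕ ×ₗ ℕ ×ₗ ℕ := fun c =>
    toLex (Fintype.card V - c.B.card, toLex (Fintype.card W - c.S.card, E₀.card - c.E.card))
  obtain ⟨c, -, hmin⟩ := (InvImage.wf μ wellFounded_lt).has_min Set.univ ⟨empty, trivial⟩
  have hB : ∀ c' : PartialEmbedding G E₀ s q φ η, ¬ c.B.card < c'.B.card := by
    intro c' h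
    refine hmin c' trivial ?_
    have := c'.two_mul_card_B
    exact Prod.Lex.toLex_lt_toLex.2 (Or.inl (by dsimp only; omega))
  have hS : ∀ c' : PartialEmbedding G E₀ s q φ η, c'.B = c.B → ¬ c.S.card < c'.S.card := by
    intro c' h1 h2
    refine hmin c' trivial ?_
    have := Finset.card_le_univ c'.S
    refine Prod.Lex.toLex_lt_toLex.2 (Or.inr ⟨by rw [h1], ?_⟩)
    exact Prod.Lex.toLex_lt_toLex.2 (Or.inl (by dsimp only; omega))
  have hE : ∀ c' : PartialEmbedding G E₀ s q φ η, c'.B = c.B → c'.S = c.S →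
      ¬ c.E.card < c'.E.card := by
    intro c' h1 h2 h3
    refine hmin c' trivial ?_
    have := Finset.card_le_card c'.E_sub
    refine Prod.Lex.toLex_lt_toLex.2 (Or.inr ⟨by rw [h1], ?_⟩)
    exact Prod.Lex.toLex_lt_toLex.2 (Or.inr ⟨by rw [h2], by dsimp only; omega⟩)
  have hX : (c.used.card : ℝ) ≤ x := le_trans (by exact_mod_cast c.card_used_le) hx
  -- the expansion of `G`, with the neighbours of a set split according to where they lie
  have hexp : ∀ U : Finset V, 2 * U.card ≤ Fintype.card V →
      α * U.card ≤ (nb G c.rest U).card + (c.B \ U).card + c.used.card := by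
    intro U hU
    have h1 := hα U (by
      rw [le_div_iff₀ two_pos]
      have : ((2 * U.card : ℕ) : ℝ) ≤ Fintype.card V := by exact_mod_cast hU
      push_cast at this
      linarith)
    have h2 : outerBoundary G U ⊆ nb G c.rest U ∪ (c.B \ U) ∪ c.used := by
      intro y hy
      simp only [outerBoundary, Finset.mem_filter, Finset.mem_univ, true_and] at hy
      simp only [Finset.mem_union, mem_nb, mem_rest, Finset.mem_sdiff]
      grind
    have h3 := (Finset.card_le_card h2).trans ((Finset.card_union_le _ _).trans
      (add_le_add_left (Finset.card_union_le _ _) _))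
    exact h1.trans (by exact_mod_cast h3)
  have hBb : (c.B.card : ℝ) ≤ b := by
    have h1 := hexp c.B c.two_mul_card_B
    have h2 := c.card_nb_rest_B
    rw [Finset.sdiff_self, Finset.card_empty] at h1
    push_cast at h1
    have h3 : (α - η) * c.B.card ≤ (α - η) * b := by linarith
    exact le_of_mul_le_mul_left h3 (by linarith)
  have hrest : (Fintype.card V : ℝ) - (b + x) ≤ c.rest.card := by
    have h1 : Fintype.card V ≤ c.rest.card + (c.B.card + c.used.card) := by
      have h2 := Finset.card_le_card_sdiff_add_card (s := Finset.univ) (t := c.B ∪ c.used)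
      have h3 := Finset.card_union_le c.B c.used
      rw [Finset.card_univ] at h2
      change _ ≤ c.rest.card + _ at h2
      omega
    have h2 : (Fintype.card V : ℝ) ≤ c.rest.card + (c.B.card + c.used.card) := by
      exact_mod_cast h1
    linarith
  have hrexp : ExpandsIn G c.rest β := by
    intro U hU hU2
    by_contra! hlt
    have hUpos : 0 < U.card := by
      rw [Finset.card_pos]
      by_contra h
      rw [Finset.not_nonempty_iff_eq_empty] at h
      subst h
      simp only [Finset.card_empty, CharP.cast_eq_zero, mul_zero] at hlt
      exact absurd hlt (not_lt.2 (Nat.cast_nonneg _))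
    have h1 := hexp U (hU2.trans (Finset.card_le_univ _))
    have h2 : ((c.B \ U).card : ℝ) ≤ c.B.card :=
      Nat.cast_le.2 (Finset.card_le_card Finset.sdiff_subset)
    have h3 : (α - β) * U.card ≤ (α - β) * u₀ := by linarith
    have h4 : (U.card : ℝ) ≤ u₀ := le_of_mul_le_mul_left h3 (by linarith)
    obtain ⟨c', hc'⟩ := c.exists_discard hU
      (hlt.le.trans (mul_le_mul_of_nonneg_right hβη (Nat.cast_nonneg _)))
      (by
        have : ((2 * (c.B.card + U.card) : ℕ) : ℝ) ≤ Fintype.card V := by push_cast; linarith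
        exact_mod_cast this)
    exact hB c' (by omega)
  have hSuniv : c.S = Finset.univ := by
    by_contra hne
    obtain ⟨w, hw⟩ : ∃ w, w ∉ c.S := by
      by_contra! h
      exact hne (Finset.eq_univ_iff_forall.2 h)
    obtain ⟨v, hv, L, K, hK, hLK, hL, hKc, hKe⟩ := hstar c.rest hrest hrexp w
    obtain ⟨c', h1, h2⟩ := c.exists_place hw hv hK hLK hL hKc hKe
    exact hS c' h1 (by omega)
  -- at each end of an edge that is not embedded, the attachable vertices have many neighbours
  have hatt : ∀ e ∈ E₀, e ∉ c.E → ∀ w ∈ e, ∃ A ⊆ c.K w, s ≤ (nb G c.rest A).card ∧ ∀ x ∈ A,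
      ∀ D ⊆ c.K w, x ∈ D → (c.E.filter fun e => w ∈ e ∧ c.t w e ∈ D).card + 1 ≤
        (bd G (c.K w) (c.L w) D).card := by
    intro e he heE w hwe
    have hwS : w ∈ c.S := hSuniv ▸ Finset.mem_univ w
    obtain ⟨T, hTK, hTc, hT⟩ := c.exists_attachable hwS
    refine ⟨c.K w \ T, Finset.sdiff_subset, ?_, fun x hx => by
      rw [Finset.mem_sdiff] at hx; exact hT x hx.1 hx.2⟩
    set d := (E₀.filter fun e => w ∈ e).card
    have hd1 : 1 ≤ d := Finset.card_pos.2 ⟨e, Finset.mem_filter.2 ⟨he, hwe⟩⟩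
    have hdE : (c.E.filter fun e => w ∈ e).card ≤ d :=
      Finset.card_le_card (Finset.filter_subset_filter _ c.E_sub)
    have h1 : 3 * (d : ℝ) ≤ (η - β) * (q w - d) := hq₁ w
    have h2 : 1 ≤ β * (q w - d) := hq₂ w hd1
    have hTd : T.card ≤ d * s := by
      rw [mul_comm]; exact hTc.trans (Nat.mul_le_mul_left s hdE)
    have hAT : (c.K w \ T).card + T.card = q w * s := by
      rw [Finset.card_sdiff_add_card_eq_card hTK, c.card_K w hwS]
    have hKT : c.K w \ (c.K w \ T) = T := by
      exact Finset.sdiff_sdiff_eq_self hTK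
    have hAc : ((q w : ℝ) - d) * s ≤ (c.K w \ T).card := by
      have h3 : ((c.K w \ T).card : ℝ) + T.card = q w * s := by exact_mod_cast hAT
      have h4 : (T.card : ℝ) ≤ d * s := by exact_mod_cast hTd
      linarith
    have hs' : (1 : ℝ) ≤ s := by exact_mod_cast hs
    have hd' : (1 : ℝ) ≤ d := by exact_mod_cast hd1
    have hAexp : β * (c.K w \ T).card ≤ (nb G c.rest (c.K w \ T)).card := by
      by_contra! hlt
      have h5 : ((c.K w \ T).card : ℝ) ≤ x := by
        refine le_trans (Nat.cast_le.2 (Finset.card_le_card fun y hy => ?_)) hX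
        exact c.mem_used.2 (Or.inl ⟨w, hwS, Finset.mem_insert_of_mem (Finset.sdiff_subset hy)⟩)
      have hAη : ((nb G c.rest (c.K w \ T)).card : ℝ) + (c.K w \ (c.K w \ T)).card + 1 +
          (c.E.filter fun e => w ∈ e).card * s ≤ η * (c.K w \ T).card := by
        rw [hKT]
        -- the unattachable vertices, the centre and the connecting sets at `w` become free
        have h6 : (T.card : ℝ) ≤ d * s := by exact_mod_cast hTd
        have h7 : ((c.E.filter fun e => w ∈ e).card : ℝ) * s ≤ d * s :=
          mul_le_mul_of_nonneg_right (by exact_mod_cast hdE) (by linarith)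
        have h8 : (1 : ℝ) ≤ d * s := one_le_mul_of_one_le_of_one_le hd' hs'
        have h9 : 3 * ((d : ℝ) * s) ≤ (η - β) * (((q w : ℝ) - d) * s) := by
          have := mul_le_mul_of_nonneg_right h1 (by linarith : (0 : ℝ) ≤ s)
          linarith
        have h10 := mul_le_mul_of_nonneg_left hAc (by linarith : 0 ≤ η - β)
        linarith
      obtain ⟨c', hc'⟩ := c.exists_unplace hwS Finset.sdiff_subset hAη (by
        have : ((2 * (c.B.card + (c.K w \ T).card) : ℕ) : ℝ) ≤ Fintype.card V := by
          push_cast; linarith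
        exact_mod_cast this)
      have hpos : 0 < (c.K w \ T).card := by
        have h6 : 0 < (q w : ℝ) - d := pos_of_mul_pos_right (by linarith) hβ.le
        have h7 : (0 : ℝ) < (c.K w \ T).card := lt_of_lt_of_le (by positivity) hAc
        exact_mod_cast h7
      exact hB c' (by omega)
    have h3 : (s : ℝ) ≤ (nb G c.rest (c.K w \ T)).card := by
      have h4 := mul_le_mul_of_nonneg_left hAc hβ.le
      have h5 := mul_le_mul_of_nonneg_right h2 (by linarith : (0 : ℝ) ≤ s)
      linarith
    exact_mod_cast h3
  refine ⟨c, hSuniv, Finset.Subset.antisymm c.E_sub fun e he => ?_⟩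
  by_contra heE
  induction e using Sym2.ind with
  | _ u v =>
    have huv : u ≠ v := fun h => hE₀ _ he (Sym2.mk_isDiag_iff.2 h)
    have huS : u ∈ c.S := hSuniv ▸ Finset.mem_univ u
    have hvS : v ∈ c.S := hSuniv ▸ Finset.mem_univ v
    obtain ⟨A₁, hA₁, hA₁s, hA₁l⟩ := hatt _ he heE u (Sym2.mem_mk_left u v)
    obtain ⟨A₂, hA₂, hA₂s, hA₂l⟩ := hatt _ he heE v (Sym2.mem_mk_right u v)
    have hA₁' := hA₁.trans (Finset.subset_insert (c.center u) _)
    have hA₂' := hA₂.trans (Finset.subset_insert (c.center v) _)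
    obtain ⟨t₁, ht₁, t₂, ht₂, Q, hQ, hQs, hQc⟩ := hconn c.rest hrest hrexp A₁ A₂
      ((c.disj_star u huS v hvS huv).mono hA₁' hA₂') ((c.disj_star_rest huS).mono_left hA₁')
      ((c.disj_star_rest hvS).mono_left hA₂') hA₁s hA₂s
    obtain ⟨c', h1, h2, h3⟩ := c.exists_connect huv he heE huS hvS (hA₁ ht₁) (hA₂ ht₂)
      (hA₁l t₁ ht₁) (hA₂l t₂ ht₂) hQ hQs hQc
    exact hE c' h1 h2 (by omega)

end PartialEmbedding
end PartialEmbedding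

/-! ### From a complete partial embedding to a topological minor -/

section Assembly

variable {V W : Type*} [Fintype V] {G : SimpleGraph V} {E₀ : Finset (Sym2 W)} {s : ℕ} {q : W → ℕ}
  {φ : Prop} {η : ℝ}

namespace PartialEmbedding

variable (c : PartialEmbedding G E₀ s q φ η)

/-- The centre of a placed vertex is joined to its attachment vertices by paths that are disjoint
except for the centre. -/
theorem exists_arms {w : W} (hw : w ∈ c.S) :
    ∃ F : Sym2 W → Finset V, (∀ e ∈ c.E, w ∈ e → F e ⊆ c.K w) ∧
      (∀ e ∈ c.E, w ∈ e → ∀ e' ∈ c.E, w ∈ e' → e ≠ e' → Disjoint (F e) (F e')) ∧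
      ∀ e ∈ c.E, w ∈ e → ∃ p : G.Walk (c.center w) (c.t w e), p.IsPath ∧
        ∀ x ∈ p.support, x = c.center w ∨ x ∈ F e := by
  have hinj : ∀ e ∈ c.E, w ∈ e → ∀ e' ∈ c.E, w ∈ e' → e ≠ e' → c.t w e ≠ c.t w e' := by
    intro e he hwe e' he' hwe' hne heq
    have h1 := c.linked w hw {c.t w e} (by simpa using c.t_mem e he w hwe)
    have h2 := (Finset.card_le_card (bd_subset (G := G) (c.K w) (c.L w) {c.t w e}))
    rw [Finset.card_singleton] at h2
    have h3 := Finset.card_le_one.1 (h1.trans h2) e (by simp [he, hwe]) e' (by simp [he', hwe', heq])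
    exact hne h3
  set E' := c.E.filter fun e => w ∈ e with hE'
  obtain ⟨R, hR1, hR2, hR3⟩ := exists_disjoint_regions (G := G) (K := c.K w) (A := c.L w)
    (T := E'.image (c.t w))
    (by
      intro x hx
      obtain ⟨e, he, rfl⟩ := Finset.mem_image.1 hx
      rw [hE', Finset.mem_filter] at he
      exact c.t_mem e he.1 w he.2)
    (fun D hD => by
      refine le_trans ?_ (c.linked w hw D hD)
      refine (Finset.card_le_card (t := (c.E.filter fun e => w ∈ e ∧ c.t w e ∈ D).image (c.t w))
        ?_).trans Finset.card_image_le
      intro x hx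
      obtain ⟨hx, hxD⟩ := Finset.mem_inter.1 hx
      obtain ⟨e, he, rfl⟩ := Finset.mem_image.1 hx
      rw [hE', Finset.mem_filter] at he
      exact Finset.mem_image_of_mem _ (Finset.mem_filter.2 ⟨he.1, he.2, hxD⟩))
  have hmem : ∀ e ∈ c.E, w ∈ e → c.t w e ∈ E'.image (c.t w) := fun e he hwe =>
    Finset.mem_image_of_mem _ (Finset.mem_filter.2 ⟨he, hwe⟩)
  refine ⟨fun e => R (c.t w e), fun e he hwe => hR1 _ (hmem e he hwe),
    fun e he hwe e' he' hwe' hne => hR3 _ (hmem e he hwe) _ (hmem e' he' hwe')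
      (hinj e he hwe e' he' hwe' hne), fun e he hwe => ?_⟩
  obtain ⟨a, ha, p, hp⟩ := hR2 _ (hmem e he hwe)
  refine ⟨(SimpleGraph.Walk.cons (c.L_adj w hw a ha) p).bypass, SimpleGraph.Walk.bypass_isPath _,
    fun x hx => ?_⟩
  have := SimpleGraph.Walk.support_bypass_subset_support _ hx
  rw [SimpleGraph.Walk.support_cons, List.mem_cons] at this
  exact this.imp id (hp x)

/-- A complete partial embedding yields an embedding as a topological minor; the parities of the
paths are chosen after the arms have been fixed. -/
theorem exists_topologicalMinor {H : SimpleGraph W} (hE₀ : ∀ e, e ∈ E₀ ↔ e ∈ H.edgeSet)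
    (hS : ∀ w, w ∈ c.S) (hE : c.E = E₀) (oddEdges : Set (Sym2 W)) :
    ∃ M : TopologicalMinor H G, φ → ∀ (u v : W) (h : H.Adj u v),
      Odd (M.edgePath h).length ↔ s(u, v) ∈ oddEdges := by
  choose F hFK hFd hFp using fun w => c.exists_arms (hS w)
  have hmemE : ∀ {u v : W}, H.Adj u v → s(u, v) ∈ c.E := fun h => by
    rw [hE, hE₀]; exact h
  have hstar : ∀ {w w' : W} {x : V}, x ∈ insert (c.center w) (c.K w) →
      x ∈ insert (c.center w') (c.K w') → w = w' := by
    intro w w' x h h'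
    by_contra hne
    exact Finset.disjoint_left.1 (c.disj_star w (hS w) w' (hS w') hne) h h'
  have hstarQ : ∀ {w : W} {e : Sym2 W} {x : V}, e ∈ c.E → x ∈ insert (c.center w) (c.K w) →
      x ∉ c.Q e := fun he h =>
    Finset.disjoint_left.1 (c.disj_star_Q _ (hS _) _ he) h
  have harm : ∀ {w : W} {e : Sym2 W} {x : V}, e ∈ c.E → w ∈ e → (x = c.center w ∨ x ∈ F w e) →
      x ∈ insert (c.center w) (c.K w) := fun he hwe h =>
    Finset.mem_insert.2 (h.imp id fun h => hFK _ _ he hwe h)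
  have hpath : ∀ (u v : W) (h : H.Adj u v), ∃ p : G.Walk (c.center u) (c.center v), p.IsPath ∧
      (∀ x ∈ p.support, (∃ w ∈ s(u, v), x = c.center w ∨ x ∈ F w s(u, v)) ∨ x ∈ c.Q s(u, v)) ∧
      (φ → (Odd p.length ↔ s(u, v) ∈ oddEdges)) := by
    intro u v h
    have he := hmemE h
    have hu : u ∈ s(u, v) := Sym2.mem_mk_left u v
    have hv : v ∈ s(u, v) := Sym2.mem_mk_right u v
    have huv : u ≠ v := h.ne
    obtain ⟨p₁, hp₁, hs₁⟩ := hFp u _ he hu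
    obtain ⟨p₂, hp₂, hs₂⟩ := hFp v _ he hv
    have ht₁ := Finset.mem_insert_of_mem (b := c.center u) (c.t_mem _ he u hu)
    have ht₂ := Finset.mem_insert_of_mem (b := c.center v) (c.t_mem _ he v hv)
    obtain ⟨r, hr, hrs, hro⟩ := c.conn u v he
      (Odd p₁.length ↔ (Odd p₂.length ↔ s(u, v) ∈ oddEdges))
    refine ⟨p₁.append (r.append p₂.reverse), ?_, ?_, ?_⟩
    · refine isPath_append hp₁ (isPath_append hr hp₂.reverse ?_) ?_
      · intro x hx hx'
        have hx2 := harm he hv (hs₂ x (by simpa using hx'))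
        rcases hrs x hx with rfl | h | h
        · exact absurd (hstar ht₁ hx2) huv
        · exact h
        · exact absurd h (hstarQ he hx2)
      · intro x hx hx'
        have hx1 := harm he hu (hs₁ x hx)
        rw [SimpleGraph.Walk.mem_support_append_iff] at hx'
        rcases hx' with hx' | hx'
        · rcases hrs x hx' with h | rfl | h
          · exact h
          · exact absurd (hstar hx1 ht₂) huv
          · exact absurd h (hstarQ he hx1)
        · exact absurd (hstar hx1 (harm he hv (hs₂ x (by simpa using hx')))) huv
    · intro x hx
      simp only [SimpleGraph.Walk.mem_support_append_iff, SimpleGraph.Walk.support_reverse,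
        List.mem_reverse] at hx
      have ht : ∀ w ∈ s(u, v), c.t w s(u, v) = c.center w ∨ c.t w s(u, v) ∈ F w s(u, v) := by
        intro w hw
        obtain ⟨p, -, hp⟩ := hFp w _ he hw
        exact hp _ p.end_mem_support
      rcases hx with hx | hx | hx
      · exact Or.inl ⟨u, hu, hs₁ x hx⟩
      · rcases hrs x hx with rfl | rfl | h
        · exact Or.inl ⟨u, hu, ht u hu⟩
        · exact Or.inl ⟨v, hv, ht v hv⟩
        · exact Or.inr h
      · exact Or.inl ⟨v, hv, hs₂ x hx⟩
    · intro hφ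
      have := hro hφ
      simp only [SimpleGraph.Walk.length_append, SimpleGraph.Walk.length_reverse, Nat.odd_add,
        ← Nat.not_odd_iff_even] at this ⊢
      tauto
  choose P hP hPs hPo using hpath
  -- a linear order on `W` selects one orientation of each edge
  let _ : LinearOrder W := IsWellOrder.linearOrder WellOrderingRel
  let ep : ∀ {u v : W}, H.Adj u v → G.Walk (c.center u) (c.center v) := fun {u v} h =>
    if u < v then P u v h else (P v u h.symm).reverse
  have hep : ∀ {u v : W} (h : H.Adj u v), (ep h).IsPath ∧
      (∀ x ∈ (ep h).support,
        (∃ w ∈ s(u, v), x = c.center w ∨ x ∈ F w s(u, v)) ∨ x ∈ c.Q s(u, v)) ∧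
      (φ → (Odd (ep h).length ↔ s(u, v) ∈ oddEdges)) := by
    intro u v h
    by_cases huv : u < v
    · simp only [ep, if_pos huv]
      exact ⟨hP u v h, hPs u v h, hPo u v h⟩
    · simp only [ep, if_neg huv, SimpleGraph.Walk.support_reverse, List.mem_reverse,
        SimpleGraph.Walk.length_reverse]
      rw [Sym2.eq_swap]
      exact ⟨(hP v u h.symm).reverse, hPs v u h.symm, hPo v u h.symm⟩
  refine ⟨{ vertexMap := c.center
            injective := fun u v h => hstar (Finset.mem_insert_self _ _)
              (h ▸ Finset.mem_insert_self _ _)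
            edgePath := ep
            isPath := fun h => (hep h).1
            edgePath_symm := ?_
            vertex_on_path := ?_
            disjoint := ?_ }, fun hφ u v h => (hep h).2.2 hφ⟩
  · intro u v h
    rcases lt_or_gt_of_ne h.ne with huv | huv
    · simp only [ep, if_pos huv, if_neg huv.not_gt]
    · simp only [ep, if_pos huv, if_neg huv.not_gt, SimpleGraph.Walk.reverse_reverse]
  · intro u v w h hw
    rcases (hep h).2.1 _ hw with ⟨w', hw', hx⟩ | hx
    · rwa [hstar (Finset.mem_insert_self _ _) (harm (hmemE h) hw' hx)]
    · exact absurd hx (hstarQ (hmemE h) (Finset.mem_insert_self _ _))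
  · intro u v u' v' h h' hne x hx hx'
    rcases (hep h).2.1 _ hx with ⟨w, hw, hxw⟩ | hxQ <;>
      rcases (hep h').2.1 _ hx' with ⟨w', hw', hxw'⟩ | hxQ'
    · obtain rfl := hstar (harm (hmemE h) hw hxw) (harm (hmemE h') hw' hxw')
      refine ⟨w, hw, hw', ?_⟩
      rcases hxw with h1 | h1
      · exact h1
      · rcases hxw' with h2 | h2
        · exact h2
        · exact absurd h2 (Finset.disjoint_left.1
            (hFd w _ (hmemE h) hw _ (hmemE h') hw' hne) h1)
    · exact absurd hxQ' (hstarQ (hmemE h') (harm (hmemE h) hw hxw))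
    · exact absurd hxQ (hstarQ (hmemE h) (harm (hmemE h') hw' hxw'))
    · exact absurd hxQ' (Finset.disjoint_left.1 (c.disj_Q _ (hmemE h) _ (hmemE h') hne) hxQ)

end PartialEmbedding
end Assembly

/-! ### The choice of parameters -/

section Constants

variable {V W : Type*} {G : SimpleGraph V}

theorem le_two_of_isExpander [Fintype V] {α : ℝ} (hα : IsExpander G α) (hn : 3 ≤ Fintype.card V) : α ≤ 2 := by
  obtain ⟨U, -, hU⟩ := Finset.exists_subset_card_eq
    (show Fintype.card V / 2 ≤ (Finset.univ : Finset V).card by rw [Finset.card_univ]; omega)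
  have h1 := hα U (by rw [hU]; exact Nat.cast_div_le)
  have h2 : (outerBoundary G U).card + U.card ≤ Fintype.card V := by
    rw [← Finset.card_union_of_disjoint]
    · exact Finset.card_le_univ _
    · exact Finset.disjoint_left.2 fun x hx => by simp [outerBoundary] at hx; exact hx.1
  have h3 : (outerBoundary G U).card ≤ 2 * U.card := by omega
  have h4 : ((outerBoundary G U).card : ℝ) ≤ 2 * U.card := by exact_mod_cast h3
  have h5 : (0 : ℝ) < U.card := by
    have : 0 < U.card := by omega
    exact_mod_cast this
  exact le_of_mul_le_mul_right (h1.trans h4) h5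

theorem exists_large_degree [Fintype V] {κ d : ℝ} (h : IsMaxDegreeRobust G κ d) {Y : Finset V}
    (hY : κ * (Fintype.card V : ℝ) ≤ Y.card) (hne : Y.Nonempty) :
    ∃ v ∈ Y, d ≤ (nb G Y {v}).card := by
  have h1 := h Y hY
  have : Nonempty (Y : Set V) := hne.to_subtype
  obtain ⟨v, hv⟩ := (G.induce (Y : Set V)).exists_maximal_degree_vertex
  refine ⟨v, v.2, h1.trans (Nat.cast_le.2 ?_)⟩
  rw [hv, ← SimpleGraph.card_neighborFinset_eq_degree,
    ← Finset.card_map (Function.Embedding.subtype _)]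
  refine Finset.card_le_card fun x hx => ?_
  obtain ⟨y, hy, rfl⟩ := Finset.mem_map.1 hx
  have hvy : G.Adj v y := by simpa using hy
  exact mem_nb.2 ⟨⟨y.2, by simpa using hvy.ne'⟩, v, by simp, hvy⟩

/-- A vertex of large degree in an expander is the centre of a star whose leaves extend to a
prescribed number of vertices, no few of which separate many others from the leaves. -/
theorem exists_star {Y : Finset V} {β : ℝ} {q s a : ℕ} {v : V} (hY : ExpandsIn G Y β)
    (hv : v ∈ Y) (ha : a ≤ (nb G Y {v}).card) (hs : 1 ≤ s) (haq : a ≤ q * s)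
    (hqY : 2 * (q * s) ≤ Y.card) (hq : q = 0 ∨ ∀ r : ℕ, a + 1 ≤ r + q → (q : ℝ) + 1 ≤ β * r) :
    ∃ v ∈ Y, ∃ L K : Finset V, K ⊆ Y.erase v ∧ L ⊆ K ∧ (∀ x ∈ L, G.Adj v x) ∧
      K.card = q * s ∧ ∀ D ⊆ K, D.card ≤ s * (bd G K L D).card := by
  obtain ⟨L, hL, hLc⟩ := Finset.exists_subset_card_eq ha
  have hLY : L ⊆ Y.erase v := fun x hx => by
    have := (mem_nb.1 (hL hx)).1
    exact Finset.mem_erase.2 ⟨by simpa using this.2, this.1⟩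
  obtain ⟨K, hK, hLK, hKc, hKe⟩ := exists_growth (G := G) (q := q) hs hLY (by rw [hLc]; exact haq)
    (fun U hU hUq hUa => by
      rcases hq with rfl | hq
      · exact Nat.zero_le _
      · rw [hLc] at hUa
        have h1 := hq _ hUa
        have h2 := hY U (hU.trans (Finset.erase_subset _ _)) (by omega)
        have h3 : nb G Y U ⊆ insert v (nb G (Y.erase v) U) := by
          intro y hy
          rw [Finset.mem_insert]
          by_cases hyv : y = v
          · exact Or.inl hyv
          · have := mem_nb.1 hy
            exact Or.inr (mem_nb.2 ⟨⟨Finset.mem_erase.2 ⟨hyv, this.1.1⟩, this.1.2⟩, this.2⟩)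
        have h4 := (Finset.card_le_card h3).trans (Finset.card_insert_le _ _)
        have h5 : (q : ℝ) + 1 ≤ (nb G Y U).card := h1.trans h2
        have h6 : q + 1 ≤ (nb G Y U).card := by exact_mod_cast h5
        omega)
  refine ⟨v, hv, L, K, hK, hLK, fun x hx => ?_, hKc, hKe⟩
  obtain ⟨-, u, hu, hux⟩ := mem_nb.1 (hL hx)
  rwa [Finset.mem_singleton.1 hu] at hux

theorem card_filter_mem_edgeFinset [Fintype W] (H : SimpleGraph W) (w : W) :
    (H.edgeFinset.filter fun e => w ∈ e).card = H.degree w := by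
  rw [← H.card_incidenceFinset_eq_degree, H.incidenceFinset_eq_filter]

theorem sum_degree_eq [Fintype W] (H : SimpleGraph W) :
    ∑ w, H.degree w = 2 * H.edgeFinset.card := by
  convert H.sum_degrees_eq_twice_card_edges

/-- The embedding process with concrete parameters.  The sets `K w` have
`⌈12 deg w / α⌉ * s` vertices, and boundaries of discarded sets are measured against `5α/6`. -/
theorem exists_topologicalMinor_of_connects [Fintype V] [Fintype W] {H : SimpleGraph W} {α β k : ℝ} {s : ℕ}
    {φ : Prop} (hα0 : 0 < α) (hn : 3 ≤ Fintype.card V) (hα : IsExpander G α)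
    (hβ : β = α / (3 * (1 + α))) (hk : 6 ≤ k) (hs : 100 / α ≤ s)
    (hsize : (Fintype.card W : ℝ) + (28 / α + 1) * (H.edgeFinset.card * s) ≤
      Fintype.card V / k / ((6 / α + 1) * (1 + 2 / α)))
    (hrob : IsMaxDegreeRobust G (1 - 4 / k) (550 * (H.maxDegree : ℝ) / α ^ 2))
    (hconn : ∀ Y : Finset V, (1 - 2 / k) * (Fintype.card V : ℝ) ≤ Y.card → ExpandsIn G Y β →
      ∀ A₁ A₂ : Finset V, Disjoint A₁ A₂ → Disjoint A₁ Y → Disjoint A₂ Y →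
        s ≤ (nb G Y A₁).card → s ≤ (nb G Y A₂).card →
        ∃ t₁ ∈ A₁, ∃ t₂ ∈ A₂, ∃ Q ⊆ Y, Q.card ≤ s ∧ Connects G φ t₁ t₂ Q)
    (oddEdges : Set (Sym2 W)) :
    ∃ M : TopologicalMinor H G, φ → ∀ (u v : W) (h : H.Adj u v),
      Odd (M.edgePath h).length ↔ s(u, v) ∈ oddEdges := by
  have hα2 : α ≤ 2 := le_two_of_isExpander hα hn
  have hV : Nonempty V := Fintype.card_pos_iff.1 (by omega)
  have hβ1 : α / 9 ≤ β := by
    rw [hβ]; exact div_le_div_of_nonneg_left hα0.le (by positivity) (by linarith)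
  have hβ2 : β ≤ α / 3 := by
    rw [hβ]; exact div_le_div_of_nonneg_left hα0.le (by positivity) (by linarith)
  have hβ0 : 0 < β := lt_of_lt_of_le (by positivity) hβ1
  have hs1 : 1 ≤ s := by
    have : (0 : ℝ) < s := lt_of_lt_of_le (by positivity) hs
    exact_mod_cast this
  set n : ℝ := (Fintype.card V : ℝ)
  have hn0 : 0 < n := by
    have : 0 < Fintype.card V := by omega
    exact Nat.cast_pos.2 this
  -- `x` bounds the used vertices, `6 / α * x` the discarded ones, and `y` both together
  set x : ℝ := n / k / ((6 / α + 1) * (1 + 2 / α)) with hx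
  set y : ℝ := n / k / (1 + 2 / α) with hy
  have hxy : 6 / α * x + x = y := by
    rw [hx, hy]; field_simp
  have hx0 : 0 ≤ x := by positivity
  have hnk : 0 < n / k := by positivity
  have hyk : y + 2 / α * y = n / k := by
    rw [hy]; field_simp
  have hy0 : 0 ≤ y := by positivity
  have hykn : y ≤ n / k := by
    have : 0 ≤ 2 / α * y := by positivity
    linarith
  have hk6 : 6 * (n / k) ≤ n := by
    rw [← mul_div_assoc, div_le_iff₀ (by linarith), mul_comm]
    exact mul_le_mul_of_nonneg_left hk hn0.le
  let q : W → ℕ := fun w => ⌈12 * (H.degree w : ℝ) / α⌉₊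
  have hq_ge : ∀ w, 12 * (H.degree w : ℝ) / α ≤ q w := fun w => Nat.le_ceil _
  have hd0 : ∀ w, 0 ≤ (H.degree w : ℝ) / α := fun w => by positivity
  have hq_le : ∀ w, (q w : ℝ) ≤ 14 * ((H.degree w : ℝ) / α) := by
    intro w
    rcases Nat.eq_zero_or_pos (H.degree w) with h | h
    · simp [q, h]
    · have h1 : (1 : ℝ) ≤ H.degree w := by exact_mod_cast h
      have h2 : (1 : ℝ) ≤ 2 * ((H.degree w : ℝ) / α) := by
        rw [← mul_div_assoc, le_div_iff₀ hα0]; linarith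
      have h3 : (q w : ℝ) < 12 * (H.degree w : ℝ) / α + 1 := Nat.ceil_lt_add_one (by positivity)
      rw [mul_div_assoc] at h3
      linarith
  have hsum : ((∑ w, (q w * s + 1) + H.edgeFinset.card * s : ℕ) : ℝ) ≤ x := by
    refine le_trans ?_ hsize
    have h1 : ∑ w, (q w : ℝ) ≤ 28 / α * H.edgeFinset.card := by
      calc ∑ w, (q w : ℝ) ≤ ∑ w, 14 * ((H.degree w : ℝ) / α) := Finset.sum_le_sum fun w _ => hq_le w
        _ = 14 / α * ((∑ w, H.degree w : ℕ) : ℝ) := by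
          push_cast
          rw [Finset.mul_sum]
          exact Finset.sum_congr rfl fun w _ => by ring
        _ = 28 / α * H.edgeFinset.card := by
          rw [sum_degree_eq]; push_cast; ring
    have h2 := mul_le_mul_of_nonneg_right h1 (Nat.cast_nonneg (α := ℝ) s)
    push_cast
    rw [Finset.sum_add_distrib, ← Finset.sum_mul]
    simp only [Finset.sum_const, Finset.card_univ, nsmul_eq_mul, mul_one]
    linarith
  have hq_le_x : ∀ w, ((q w * s : ℕ) : ℝ) ≤ x := by
    intro w
    refine le_trans (Nat.cast_le.2 ?_) hsum
    have := Finset.single_le_sum (f := fun w => q w * s + 1) (fun i _ => Nat.zero_le _)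
      (Finset.mem_univ w)
    omega
  have hdiv : ∀ w, 10 * ((H.degree w : ℝ) / α) ≤ q w - H.degree w := by
    intro w
    have h1 := hq_ge w
    have h2 : (H.degree w : ℝ) ≤ 2 * ((H.degree w : ℝ) / α) := by
      rw [← mul_div_assoc, le_div_iff₀ hα0, mul_comm]
      exact mul_le_mul_of_nonneg_right hα2 (Nat.cast_nonneg _)
    rw [mul_div_assoc] at h1
    linarith
  have hcancel : ∀ w, α * ((H.degree w : ℝ) / α) = H.degree w := fun w => by field_simp
  obtain ⟨c, hcS, hcE⟩ := PartialEmbedding.exists_complete (G := G) (E₀ := H.edgeFinset) (q := q)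
    (φ := φ) (η := 5 * α / 6) (x := x) (b := 6 / α * x) (u₀ := 2 / α * y) hα hβ0
    (by linarith) (by linarith) hs1
    (fun e he => H.not_isDiag_of_mem_edgeSet (by simpa using he)) hsum
    (by
      have : (α - 5 * α / 6) * (6 / α * x) = x := by field_simp; ring
      linarith)
    (by
      rw [hxy]
      have h1 : (α - α / 3) * (2 / α * y) = 4 / 3 * y := by field_simp; ring
      have h2 : (α - α / 3) * (2 / α * y) ≤ (α - β) * (2 / α * y) :=
        mul_le_mul_of_nonneg_right (by linarith) (by positivity)
      linarith)
    (by rw [hxy]; linarith) (by linarith)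
    (fun w => by
      rw [card_filter_mem_edgeFinset]
      have h1 := hdiv w
      have h2 : α / 2 * (10 * ((H.degree w : ℝ) / α)) ≤
          (5 * α / 6 - β) * (q w - H.degree w) :=
        mul_le_mul (by linarith) h1 (by linarith [hd0 w]) (by linarith)
      have h3 := hcancel w
      have h4 : (0 : ℝ) ≤ H.degree w := Nat.cast_nonneg _
      linarith)
    (fun w hw => by
      rw [card_filter_mem_edgeFinset] at hw ⊢
      have h1 := hdiv w
      have h2 : α / 9 * (10 * ((H.degree w : ℝ) / α)) ≤ β * (q w - H.degree w) :=
        mul_le_mul hβ1 h1 (by linarith [hd0 w]) hβ0.le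
      have h3 := hcancel w
      have h4 : (1 : ℝ) ≤ H.degree w := by exact_mod_cast hw
      linarith)
    (fun Y hY hYe w => by
      rw [hxy] at hY
      have hYpos : 0 < Y.card := by
        have : (0 : ℝ) < Y.card := by linarith
        exact_mod_cast this
      obtain ⟨v, hv, hdeg⟩ := exists_large_degree hrob (Y := Y) (by
        have h1 : (1 - 4 / k) * n = n - 4 * (n / k) := by ring
        change (1 - 4 / k) * n ≤ _
        linarith) (Finset.card_pos.1 hYpos)
      have hdeg' : 550 * (H.degree w : ℝ) / α ^ 2 ≤ (nb G Y {v}).card := by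
        refine le_trans ?_ hdeg
        have : (H.degree w : ℝ) ≤ H.maxDegree := by exact_mod_cast H.degree_le_maxDegree w
        gcongr
      have hsq : 550 * (H.degree w : ℝ) / α ^ 2 = 550 * ((H.degree w : ℝ) / α) / α := by
        field_simp
      refine exists_star (a := ⌊550 * (H.degree w : ℝ) / α ^ 2⌋₊) hYe hv
        (Nat.floor_le_of_le hdeg') hs1 (Nat.floor_le_of_le ?_) ?_ ?_
      · have h1 : 12 * (H.degree w : ℝ) / α * (100 / α) ≤ q w * s :=
          mul_le_mul (hq_ge w) hs (by positivity) (Nat.cast_nonneg _)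
        have h2 : 12 * (H.degree w : ℝ) / α * (100 / α) = 1200 * ((H.degree w : ℝ) / α) / α := by
          ring
        have h3 : 550 * ((H.degree w : ℝ) / α) / α ≤ 1200 * ((H.degree w : ℝ) / α) / α := by
          have := hd0 w
          gcongr
          linarith
        push_cast
        linarith
      · have h1 := hq_le_x w
        have h2 : ((2 * (q w * s) : ℕ) : ℝ) ≤ Y.card := by
          rw [Nat.cast_mul]
          have : x ≤ y := by
            have : 0 ≤ 6 / α * x := by positivity
            linarith
          push_cast at h1 ⊢
          linarith
        exact_mod_cast h2
      · rcases Nat.eq_zero_or_pos (H.degree w) with h | h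
        · exact Or.inl (by simp [q, h])
        · refine Or.inr fun r hr => ?_
          have h1 : (1 : ℝ) ≤ H.degree w := by exact_mod_cast h
          have h2 : (1 : ℝ) ≤ 2 * ((H.degree w : ℝ) / α) := by
            rw [← mul_div_assoc, le_div_iff₀ hα0]; linarith
          have h3 := Nat.lt_floor_add_one (550 * (H.degree w : ℝ) / α ^ 2)
          have h4 : ((⌊550 * (H.degree w : ℝ) / α ^ 2⌋₊ : ℕ) : ℝ) + 1 ≤ r + q w := by
            exact_mod_cast hr
          have h5 := hq_le w
          have h6 : (H.degree w : ℝ) / α ≤ 2 * ((H.degree w : ℝ) / α / α) := by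
            rw [← mul_div_assoc, le_div_iff₀ hα0, mul_comm]
            exact mul_le_mul_of_nonneg_right hα2 (hd0 w)
          have h7 : 522 * ((H.degree w : ℝ) / α / α) ≤ r := by
            rw [hsq, mul_div_assoc] at h3 h4
            linarith
          have h8 : α / 9 * (522 * ((H.degree w : ℝ) / α / α)) ≤ β * r :=
            mul_le_mul hβ1 h7 (by positivity) hβ0.le
          have h9 : α / 9 * (522 * ((H.degree w : ℝ) / α / α)) = 58 * ((H.degree w : ℝ) / α) := by
            field_simp; ring
          linarith [hd0 w])
    (fun Y hY hYe => by
      rw [hxy] at hY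
      refine hconn Y ?_ hYe
      have h1 : (1 - 2 / k) * n = n - 2 * (n / k) := by ring
      linarith)
  exact c.exists_topologicalMinor (fun e => by simp) (fun w => hcS ▸ Finset.mem_univ w) hcE oddEdges

end Constants

/-! ### Constants depending on the expansion only -/

section Main

/-- An odd cycle in an induced subgraph, as a cycle of the whole graph. -/
theorem exists_cycle_of_isOddCycleRobust {V : Type*} [Fintype V] {G : SimpleGraph V} {κ β ℓ : ℝ}
    (h : IsOddCycleRobust G κ β ℓ) {Y : Finset V} (hY : κ * (Fintype.card V : ℝ) ≤ Y.card)
    (hYe : ExpandsIn G Y β) :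
    ∃ (v : V) (c : G.Walk v v), c.IsCycle ∧ Odd c.length ∧ (∀ x ∈ c.support, x ∈ Y) ∧
      ℓ ≤ (c.length : ℝ) ∧
      (c.length : ℝ) ≤ 3 * diamConst (β / 2) * Real.logb 2 (Fintype.card V : ℝ) := by
  obtain ⟨v, c, hc, ho, h1, h2⟩ := h Y hY (expandsIn_iff_isExpander_induce.1 hYe)
  let f := (SimpleGraph.Embedding.induce (G := G) (Y : Set V)).toHom
  have hf : Function.Injective f := Subtype.val_injective
  refine ⟨f v, c.map f, hc.map hf, by simpa using ho, ?_, by simpa using h1, by simpa using h2⟩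
  intro x hx
  rw [SimpleGraph.Walk.support_map, List.mem_map] at hx
  obtain ⟨y, -, rfl⟩ := hx
  exact y.2

theorem card_lt_pow_of_lt_mul_logb {n δ : ℝ} {N : ℕ} (hn : 0 < n) (hδ : 0 < δ)
    (h : Real.logb 2 n < N * Real.logb 2 (1 + δ)) : n < (1 + δ) ^ N := by
  rwa [← Real.logb_lt_logb_iff one_lt_two hn (by positivity), Real.logb_pow]

end Main
end ExpanderEmbedding

theorem mainTheorem2 (α : ℝ) (hα : 0 < α) :
    ∃ ε : ℝ, 0 < ε ∧ ∃ n₀ : ℕ, 0 < n₀ ∧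
      ∀ (V : Type u) [Fintype V] (G : SimpleGraph V) (k : ℝ)
        (W : Type v) [Fintype W] (H : SimpleGraph W) [DecidableRel H.Adj],
        n₀ < Fintype.card V →
        ExpanderEmbedding.IsExpander G α →
        6 ≤ k →
        (Fintype.card W : ℝ) ≤
          ε * (Fintype.card V : ℝ) / (k * Real.logb 2 (Fintype.card V : ℝ)) →
        (H.edgeSet.ncard : ℝ) ≤
          ε * (Fintype.card V : ℝ) / (k * Real.logb 2 (Fintype.card V : ℝ)) →
        ExpanderEmbedding.IsMaxDegreeRobust G (1 - 4 / k) (550 * (H.maxDegree : ℝ) / α ^ 2) →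
        Nonempty (ExpanderEmbedding.TopologicalMinor H G) ∧
        ∀ β : ℝ, β = α / (3 * (1 + α)) →
          ExpanderEmbedding.IsOddCycleRobust G (1 - 2 / k) β (1 + 2 / β) →
          ∀ oddEdges : Set (Sym2 W),
            ∃ M : ExpanderEmbedding.TopologicalMinor H G,
              ∀ (u v : W) (h : H.Adj u v), Odd (M.edgePath h).length ↔ s(u, v) ∈ oddEdges := by
  obtain ⟨β, hβ⟩ : ∃ β : ℝ, β = α / (3 * (1 + α)) := ⟨_, rfl⟩
  have hβ0 : 0 < β := by rw [hβ]; positivity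
  obtain ⟨r, hr⟩ : ∃ r : ℝ, r = Real.logb 2 (1 + β / 2) := ⟨_, rfl⟩
  have hr0 : 0 < r := by rw [hr]; exact Real.logb_pos one_lt_two (by linarith)
  obtain ⟨m, hm⟩ : ∃ m : ℕ, m = ⌈4 / β⌉₊ + 1 := ⟨_, rfl⟩
  have hm' : 4 / β + 1 ≤ m := by
    rw [hm]; push_cast; linarith [Nat.le_ceil (4 / β)]
  obtain ⟨d, hd⟩ : ∃ d : ℝ, d = 3 * ExpanderEmbedding.diamConst (β / 2) := ⟨_, rfl⟩
  have hd0 : 0 < d := by rw [hd, ExpanderEmbedding.diamConst, ← hr]; positivity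
  -- a connecting set has at most `C * log n` vertices
  obtain ⟨C, hC⟩ : ∃ C : ℝ, C = d + m + 6 * (1 / r + 1) + 5 + 100 / α := ⟨_, rfl⟩
  have hC0 : 0 < C := by rw [hC]; positivity
  obtain ⟨D, hD⟩ : ∃ D : ℝ, D = 1 + (28 / α + 1) * (C + 1) := ⟨_, rfl⟩
  have hD0 : 0 < D := by rw [hD]; positivity
  have hτ : 0 < (6 / α + 1) * (1 + 2 / α) := by positivity
  refine ⟨1 / (D * ((6 / α + 1) * (1 + 2 / α))), by positivity, 3, by norm_num, ?_⟩
  intro V _ G k W _ H _ hn hexp hk hW hE hrob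
  have hn4 : (4 : ℝ) ≤ Fintype.card V := by exact_mod_cast hn
  obtain ⟨ℓ, hℓ⟩ : ∃ ℓ : ℝ, ℓ = Real.logb 2 (Fintype.card V : ℝ) := ⟨_, rfl⟩
  have hℓ1 : 1 ≤ ℓ := by
    rw [hℓ, Real.le_logb_iff_rpow_le one_lt_two (by linarith)]
    norm_num
    linarith
  -- `N` steps of growth by the factor `1 + β / 2` exceed `n`
  obtain ⟨N, hN⟩ : ∃ N : ℕ, N = ⌊ℓ / r⌋₊ + 1 := ⟨_, rfl⟩
  have hNr : ℓ < N * r := by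
    rw [← div_lt_iff₀ hr0, hN]
    exact_mod_cast Nat.lt_floor_add_one (ℓ / r)
  have hNle : (N : ℝ) ≤ (1 / r + 1) * ℓ := by
    have h1 := Nat.floor_le (div_nonneg (by linarith : 0 ≤ ℓ) hr0.le)
    have h2 : (1 / r + 1) * ℓ = ℓ / r + ℓ := by ring
    rw [hN]
    push_cast
    linarith
  have hpow : (Fintype.card V : ℝ) < (1 + β / 2) ^ N :=
    ExpanderEmbedding.card_lt_pow_of_lt_mul_logb (by linarith) (by linarith) (by rw [← hℓ, ← hr]; exact hNr)
  have hpow' : (Fintype.card V : ℝ) < (1 + β) ^ N :=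
    hpow.trans_le (pow_le_pow_left₀ (by positivity) (by linarith) _)
  obtain ⟨s, hs⟩ : ∃ s : ℕ, s = ⌈C * ℓ⌉₊ := ⟨_, rfl⟩
  have hs_ge : C * ℓ ≤ s := by rw [hs]; exact Nat.le_ceil _
  have hs_le : (s : ℝ) ≤ (C + 1) * ℓ := by
    have : (s : ℝ) < C * ℓ + 1 := by rw [hs]; exact Nat.ceil_lt_add_one (by positivity)
    linarith
  have hs_ge' : d * ℓ + m + 6 * N + 5 + 100 / α ≤ s := by
    have h1 : (m : ℝ) ≤ m * ℓ := le_mul_of_one_le_right (Nat.cast_nonneg _) hℓ1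
    have h2 : 100 / α ≤ 100 / α * ℓ := le_mul_of_one_le_right (by positivity) hℓ1
    have h3 : C * ℓ = d * ℓ + m * ℓ + 6 * ((1 / r + 1) * ℓ) + 5 * ℓ + 100 / α * ℓ := by
      rw [hC]; ring
    linarith
  have hdℓ : 0 < d * ℓ := by positivity
  have h100 : 0 < 100 / α := by positivity
  have hs_nat : m + 6 * N + 5 ≤ s := by
    have : ((m + 6 * N + 5 : ℕ) : ℝ) ≤ s := by push_cast; linarith
    exact_mod_cast this
  have hs100 : 100 / α ≤ s := by
    have : (0 : ℝ) ≤ m + 6 * N + 5 := by positivity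
    linarith
  have hsize : (Fintype.card W : ℝ) + (28 / α + 1) * (H.edgeFinset.card * s) ≤
      Fintype.card V / k / ((6 / α + 1) * (1 + 2 / α)) := by
    have hk0 : 0 < k := by linarith
    rw [← hℓ] at hW hE
    rw [← SimpleGraph.coe_edgeFinset, Set.ncard_coe_finset] at hE
    set z : ℝ := Fintype.card V / k / ((6 / α + 1) * (1 + 2 / α)) with hz
    have hz0 : 0 ≤ z := by positivity
    have hbound : 1 / (D * ((6 / α + 1) * (1 + 2 / α))) * (Fintype.card V : ℝ) / (k * ℓ) =
        z / D / ℓ := by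
      rw [hz]; field_simp
    rw [hbound] at hW hE
    have h1 : z / D / ℓ ≤ z / D := div_le_self (by positivity) hℓ1
    have h2 : (H.edgeFinset.card : ℝ) * s ≤ z / D / ℓ * ((C + 1) * ℓ) :=
      mul_le_mul hE hs_le (Nat.cast_nonneg _) (by positivity)
    have h3 : z / D / ℓ * ((C + 1) * ℓ) = (C + 1) * (z / D) := by field_simp
    have h4 : (28 / α + 1) * (H.edgeFinset.card * s) ≤ (28 / α + 1) * ((C + 1) * (z / D)) :=
      mul_le_mul_of_nonneg_left (h2.trans h3.le) (by positivity)
    have h5 : z / D + (28 / α + 1) * ((C + 1) * (z / D)) = z := by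
      have : z / D + (28 / α + 1) * ((C + 1) * (z / D)) = D * (z / D) := by rw [hD]; ring
      rw [this]; field_simp
    linarith
  have hYpow : ∀ Y : Finset V, (Y.card : ℝ) ≤ Fintype.card V := fun Y =>
    Nat.cast_le.2 (Finset.card_le_univ Y)
  constructor
  · obtain ⟨M, -⟩ := ExpanderEmbedding.exists_topologicalMinor_of_connects (φ := False) (H := H) hα
      (by omega) hexp hβ hk hs100 (by convert hsize) (by convert hrob)
      (fun Y _ hYe A₁ A₂ _ _ _ h1 h2 => by
        have h1' : (ExpanderEmbedding.nb G Y A₁).Nonempty := Finset.card_pos.1 (by omega)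
        have h2' : (ExpanderEmbedding.nb G Y A₂).Nonempty := Finset.card_pos.1 (by omega)
        obtain ⟨t₁, ht₁, t₂, ht₂, Q, hQ, hQc, hc⟩ := ExpanderEmbedding.exists_connects_false hβ0 hYe
          ((hYpow Y).trans_lt hpow') h1' h2'
        exact ⟨t₁, ht₁, t₂, ht₂, Q, hQ, by omega, hc⟩) ∅
    exact ⟨M⟩
  · intro β' hβ' hodd oddEdges
    obtain rfl : β' = β := hβ'.trans hβ.symm
    obtain ⟨M, hM⟩ := ExpanderEmbedding.exists_topologicalMinor_of_connects (φ := True) (H := H) hα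
      (by omega) hexp hβ hk hs100 (by convert hsize) (by convert hrob)
      (fun Y hY hYe A₁ A₂ hA hA₁ hA₂ h1 h2 => by
        obtain ⟨v, c, hc, ho, hcY, hcl, hcu⟩ :=
          ExpanderEmbedding.exists_cycle_of_isOddCycleRobust hodd hY hYe
        obtain ⟨t₁, ht₁, t₂, ht₂, Q, hQ, hQc, hcon⟩ := ExpanderEmbedding.exists_connects_true hβ0 hYe
          ((hYpow Y).trans_lt hpow) hc ho hcY hcl hA hA₁ hA₂ (Finset.card_pos.1 (by omega)) hm'
          (by omega)
        refine ⟨t₁, ht₁, t₂, ht₂, Q, hQ, ?_, hcon⟩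
        rw [← hd, ← hℓ] at hcu
        have h3 : (Q.card : ℝ) ≤ c.length + m + 6 * N + 5 := by exact_mod_cast hQc
        have h4 : (Q.card : ℝ) ≤ s := by linarith
        exact_mod_cast h4) oddEdges
    exact ⟨M, hM trivial⟩
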